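/- An \emph{exponential field} is a field $F$ of characteristic zero with a group homomorphism $\exp : (F,+) \to (F^\times,\cdot)$; it is an \emph{EA-field} if $F$ is algebraically closed. Let $\mathbf{EAF}$ be the category of EA-fields, regarded as structures in the language $\langle +,\cdot,-,0,1,\exp\rangle$, with all embeddings of exponential fields as arrows. For subsets $A,B,C$ of a field write $A \perp^{\mathrm{td}}_C B$ if $\mathrm{td}(D/B\cup C)=\mathrm{td}(D/C)$ for every finite $D\subseteq A$, where $\mathrm{td}(D/C)$ is the transcendence degree of the field generated by $C\cup D$ over the field generated by $C$. For an EA-field $F$ and $A\subseteq F$ let $\langle A\rangle^{EA}$ be the smallest EA-subfield of $F$ (algebraically closed subfield closed under $\exp$) containing $A$. For $A,B,C\subseteq F$ define $A \perp^{EA,F}_C B$ to mean $\langle A\cup C\rangle^{EA} \perp^{\mathrm{td}}_{\langle C\rangle^{EA}} \langle B\cup C\rangle^{EA}$; we drop $F$ from the notation when it is clear. A \emph{clubset} of $[X]^{<\lambda}=\{Y\subseteq X : |Y|<\lambda\}$ is a family $\mathcal B\subseteq[X]^{<\lambda}$ such that every element of $[X]^{<\lambda}$ is contained in an element of $\mathcal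 B$ and the union of every non-empty well-ordered chain in $\mathcal B$ of length less than $\lambda$ is in $\mathcal B$. Tuples $a_1$ in $M_1$ and $a_2$ in $M_2$, indexed by the same set, \emph{have the same Galois type} if there are arrows $g_i : M_i\to N$ $(i=1,2)$ with $g_1(a_1)=g_2(a_2)$; they have the same Galois type over a set of common parameters if this holds after appending an enumeration of the parameters to both tuples. \textbf{Theorem.} The category $\mathbf{EAF}$ is an abstract elementary class with the amalgamation property, that is: its arrows are embeddings of structures in the above language; it is closed under isomorphisms; it satisfies coherence (if $f:M_1\to N$ and $g:M_2\to N$ are arrows with $f(M_1)\subseteq g(M_2)$, then $f=g\circ h$ for some arrow $h:M_1\to M_2$); it is closed under unions of non-empty well-ordered chains; it has the downwards L\"owenheim--Skolem property (there is an infinite cardinal $\kappa$ such that every subset $S$ of an object $M$ is contained in a subobject of cardinality at most $|S|+\kappa$); and any two arrows $M_1\leftarrow M\to M_2$ can be completed to a commuting square. The relation $\perp^{EA}$ is an NSOP$_1$-like independence relation on $\mathbf{EAF}$, that is: 1. (Basic properties) On every EA-field $M$, for all $A,B,C,D\subseteq M$: if $A\perp_C B$ then $A\perp_C B\cup C$;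 $A\perp_C C$; if $A\perp_C B$ and $D\subseteq B$ then $A\perp_C D$; if $A\perp_C D$, $A\perp_D B$ and $C\subseteq D$ then $A\perp_C B$; if $A\perp_C B$ then $B\perp_C A$; if $D\perp_C B$ for all finite $D\subseteq A$ then $A\perp_C B$. 2. (Invariance) For every arrow $f:M\to N$ and $A,B,C\subseteq M$: $A\perp^{M}_C B$ if and only if $f(A)\perp^{N}_{f(C)} f(B)$. 3. (Club Local Character) There is a regular cardinal $\lambda$ such that for every EA-field $M$, every finite $A\subseteq M$ and every $B\subseteq M$ there is a clubset $\mathcal B\subseteq [B]^{<\lambda}$ with $A\perp_{B_0} B$ for all $B_0\in\mathcal B$. 4. (Extension) If $a$ is a possibly infinite tuple in $M$, $a\perp^M_C B$ and $B\subseteq B'\subseteq M$, then there are an extension $M\hookrightarrow N$ in $\mathbf{EAF}$ and a tuple $a'$ in $N$ with $a'\perp^N_C B'$ such that $a'$ in $N$ and $a$ in $M$ have the same Galois type over $B\cup C$. 5. (3-amalgamation) Given arrows $M\to M_i$ $(i=1,2,3)$ and $M_i\to M_{ij}$, $M_j\to M_{ij}$ $(1\le i<j\le 3)$ with $M\to M_i\to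 M_{ij}$ equal to $M\to M_j\to M_{ij}$, such that $M_1\perp_M^{M_{12}}M_2$, $M_2\perp_M^{M_{23}}M_3$ and $M_3\perp_M^{M_{13}}M_1$ (identifying objects with their images), there are an EA-field $N$ and arrows $M_{12},M_{13},M_{23}\to N$ that make the whole diagram commute, with $M_1\perp_M^N M_{23}$. However, $\perp^{EA}$ is not a simple independence relation: it does not satisfy Base-Monotonicity (if $A\perp_C B$ and $C\subseteq D\subseteq B$ then $A\perp_D B$). In fact every EA-field $C$ has an EA-field extension $F$ with EA-subfields $A,B,D$ such that $C\subseteq A$, $C\subseteq D\subseteq B$ and $A\perp^{EA}_C B$, but not $A\perp^{EA}_D B$. -/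

import Mathlib

open CategoryTheory FirstOrder Cardinal

universe u v w x

namespace IndepRel

/-! ### Independence relations on a set

A ternary relation on subsets is written `R A B C`: "`A` is independent from `B` over `C`". -/

section OnASet

variable {α : Type u}

/-- The six basic properties of an independence relation on (the underlying set of) a structure. -/
structure IsIndependenceRelation (R : Set α → Set α → Set α → Prop) : Prop where
  normality : ∀ A B C, R A B C → R A (B ∪ C) C
  existence : ∀ A C, R A C C
  monotonicity : ∀ A B C D, R A B C → D ⊆ B → R A D C
  transitivity : ∀ A B C D, R A D C → R A B D → C ⊆ D → R A B C
  symmetry : ∀ A B C, R A B C → R B A C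
  finite_character : ∀ A B C, (∀ D, D ⊆ A → D.Finite → R D B C) → R A B C

/-- If `A` is independent from `B` over `C` and `C ⊆ D ⊆ B`, then `A` is independent from `B`
over `D`. -/
def BaseMonotonicity (R : Set α → Set α → Set α → Prop) : Prop :=
  ∀ A B C D, R A B C → C ⊆ D → D ⊆ B → R A B D

/-- `𝓑` is a clubset of `[X]^{<κ} = {Y ⊆ X : |Y| < κ}`. Chains of length `< κ` are indexed by
nonempty well-ordered types of cardinality `< κ`. -/
structure IsClubset (κ : Cardinal.{u}) (X : Set α) (𝓑 : Set (Set α)) : Prop where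
  subset : ∀ Y ∈ 𝓑, Y ⊆ X ∧ #Y < κ
  unbounded : ∀ Z : Set α, Z ⊆ X → #Z < κ → ∃ Y ∈ 𝓑, Z ⊆ Y
  closed : ∀ (ι : Type u) [LinearOrder ι] [WellFoundedLT ι] [Nonempty ι] (Y : ι → Set α),
    #ι < κ → Monotone Y → (∀ i, Y i ∈ 𝓑) → (⋃ i, Y i) ∈ 𝓑

end OnASet

/-! ### Concrete categories of structures -/

section OnACategory

variable {C : Type (u + 1)} [Category.{u} C] {FC : C → C → Type u} {CC : C → Type u}
  [∀ X Y, FunLike (FC X Y) (CC X) (CC Y)] [ConcreteCategory C FC]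

/-- The concrete category `C`, whose objects carry `L`-structures, is an abstract elementary
class. Everything is expressed by arrows, instead of literal inclusions. -/
structure IsAEC (L : FirstOrder.Language.{v, w}) (C : Type (u + 1)) [Category.{u} C]
    {FC : C → C → Type u} {CC : C → Type u} [∀ X Y, FunLike (FC X Y) (CC X) (CC Y)]
    [ConcreteCategory C FC] [str : ∀ M : C, L.Structure (CC M)] : Prop where
  /-- Every arrow is an `L`-embedding. -/
  arrow_embedding : ∀ {M N : C} (f : M ⟶ N), ∃ g : CC M ↪[L] CC N, ∀ a : CC M, g a = f a
  /-- Every `L`-isomorphism between objects is an arrow. -/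
  iso_arrow : ∀ {M N : C} (e : CC M ≃[L] CC N), ∃ f : M ⟶ N, ∀ a : CC M, f a = e a
  /-- Every `L`-structure that is isomorphic to an object is an object. -/
  iso_object : ∀ (M : C) (B : Type u) [SB : L.Structure B], Nonempty (CC M ≃[L] B) →
    ∃ N : C, (⟨CC N, str N⟩ : Bundled.{u} L.Structure) = ⟨B, SB⟩
  /-- Coherence. -/
  coherence : ∀ {M₁ M₂ N : C} (f : M₁ ⟶ N) (g : M₂ ⟶ N), Set.range f ⊆ Set.range g →
    ∃ h : M₁ ⟶ M₂, h ≫ g = f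
  /-- Unions of (nonempty) well-ordered chains. -/
  chains : ∀ (ι : Type u) [LinearOrder ι] [WellFoundedLT ι] [Nonempty ι] (D : ι ⥤ C),
    ∃ (U : C) (c : ∀ i, D.obj i ⟶ U),
      (∀ (i j : ι) (h : i ⟶ j), D.map h ≫ c j = c i) ∧
      (⋃ i, Set.range (c i)) = Set.univ ∧
      ∀ (N : C) (d : ∀ i, D.obj i ⟶ N), (∀ (i j : ι) (h : i ⟶ j), D.map h ≫ d j = d i) →
        ∃ k : U ⟶ N, ∀ i, c i ≫ k = d i
  /-- The downwards Löwenheim-Skolem property. -/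
  lowenheim_skolem : ∃ κ : Cardinal.{u}, ℵ₀ ≤ κ ∧ ∀ (M : C) (S : Set (CC M)),
    ∃ (N : C) (f : N ⟶ M), S ⊆ Set.range f ∧ #(CC N) ≤ #S + κ

/-- Every object is an amalgamation base. -/
def HasAmalgamation (C : Type (u + 1)) [Category.{u} C] : Prop :=
  ∀ {M M₁ M₂ : C} (f₁ : M ⟶ M₁) (f₂ : M ⟶ M₂),
    ∃ (N : C) (g₁ : M₁ ⟶ N) (g₂ : M₂ ⟶ N), f₁ ≫ g₁ = f₂ ≫ g₂

/-- The tuples `a` in `M₁` and `b` in `M₂` have the same Galois type. -/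
def SameGaloisType {M₁ M₂ : C} {ι : Type x} (a : ι → ToType M₁) (b : ι → ToType M₂) : Prop :=
  ∃ (N : C) (g₁ : M₁ ⟶ N) (g₂ : M₂ ⟶ N), ∀ i, g₁ (a i) = g₂ (b i)

/-- For a set of parameters `P` in `M` and an extension `f : M ⟶ N`, the tuple `a'` in `N` (over
the image of `P`) and the tuple `a` in `M` have the same Galois type over `P`. -/
def SameGaloisTypeOver {M N : C} (f : M ⟶ N) (P : Set (ToType M)) {ι : Type x}
    (a' : ι → ToType N) (a : ι → ToType M) : Prop :=
  SameGaloisType (M₁ := N) (M₂ := M)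
    (Sum.elim a' fun p : P => f p.1) (Sum.elim a fun p : P => p.1)

variable (Ind : ∀ M : C, Set (ToType M) → Set (ToType M) → Set (ToType M) → Prop)

def Invariance : Prop :=
  ∀ {M N : C} (f : M ⟶ N) (A B P : Set (ToType M)),
    Ind M A B P ↔ Ind N (f '' A) (f '' B) (f '' P)

/-- An independence relation on the concrete category `C`. -/
structure IsIndependenceRelationOn : Prop where
  basic : ∀ M : C, IsIndependenceRelation (Ind M)
  invariance : Invariance Ind

def ClubLocalCharacter : Prop :=
  ∃ κ : Cardinal.{u}, κ.IsRegular ∧ ∀ (M : C) (A B : Set (ToType M)), A.Finite →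
    ∃ 𝓑 : Set (Set (ToType M)), IsClubset κ B 𝓑 ∧ ∀ B₀ ∈ 𝓑, Ind M A B B₀

def Extension : Prop :=
  ∀ (M : C) (ι : Type u) (a : ι → ToType M) (B B' P : Set (ToType M)),
    Ind M (Set.range a) B P → B ⊆ B' →
    ∃ (N : C) (f : M ⟶ N) (a' : ι → ToType N),
      Ind N (Set.range a') (f '' B') (f '' P) ∧ SameGaloisTypeOver f (B ∪ P) a' a

/-- `3`-amalgamation: the arrows `mᵢ : M ⟶ Mᵢ` and `pᵢⱼ, qᵢⱼ` from `Mᵢ` and `Mⱼ` to `Mᵢⱼ` are the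
solid arrows of the cube, and `gᵢⱼ : Mᵢⱼ ⟶ N` are the dashed ones. -/
def ThreeAmalgamation : Prop :=
  ∀ {M M₁ M₂ M₃ M₁₂ M₁₃ M₂₃ : C} (m₁ : M ⟶ M₁) (m₂ : M ⟶ M₂) (m₃ : M ⟶ M₃)
    (p₁₂ : M₁ ⟶ M₁₂) (q₁₂ : M₂ ⟶ M₁₂) (p₁₃ : M₁ ⟶ M₁₃) (q₁₃ : M₃ ⟶ M₁₃)
    (p₂₃ : M₂ ⟶ M₂₃) (q₂₃ : M₃ ⟶ M₂₃),
    m₁ ≫ p₁₂ = m₂ ≫ q₁₂ → m₁ ≫ p₁₃ = m₃ ≫ q₁₃ → m₂ ≫ p₂₃ = m₃ ≫ q₂₃ →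
    Ind M₁₂ (Set.range p₁₂) (Set.range q₁₂) (Set.range (m₁ ≫ p₁₂)) →
    Ind M₂₃ (Set.range p₂₃) (Set.range q₂₃) (Set.range (m₂ ≫ p₂₃)) →
    Ind M₁₃ (Set.range q₁₃) (Set.range p₁₃) (Set.range (m₃ ≫ q₁₃)) →
    ∃ (N : C) (g₁₂ : M₁₂ ⟶ N) (g₁₃ : M₁₃ ⟶ N) (g₂₃ : M₂₃ ⟶ N),
      p₁₂ ≫ g₁₂ = p₁₃ ≫ g₁₃ ∧ q₁₂ ≫ g₁₂ = p₂₃ ≫ g₂₃ ∧ q₁₃ ≫ g₁₃ = q₂₃ ≫ g₂₃ ∧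
      Ind N (Set.range (p₁₂ ≫ g₁₂)) (Set.range g₂₃) (Set.range (m₁ ≫ p₁₂ ≫ g₁₂))

/-- An NSOP₁-like independence relation. -/
structure IsNSOP1Like : Prop extends IsIndependenceRelationOn Ind where
  club_local_character : ClubLocalCharacter Ind
  extension : Extension Ind
  three_amalgamation : ThreeAmalgamation Ind

/-- A simple independence relation. -/
structure IsSimple : Prop extends IsNSOP1Like Ind where
  base_monotonicity : ∀ M : C, BaseMonotonicity (Ind M)

end OnACategory

end IndepRel

namespace ExpFields

/-! ### Exponential fields -/

/-- An exponential field: a field of characteristic zero with a homomorphism from its additive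
group to its multiplicative group. -/
class ExponentialField (F : Type u) extends Field F, CharZero F where
  expHom : Multiplicative F →* Fˣ

/-- The exponential map, as a function from `F` to `F`. -/
def expo {F : Type u} [ExponentialField F] (a : F) : F :=
  (ExponentialField.expHom (F := F) (Multiplicative.ofAdd a) : Fˣ)

/-- Embeddings of exponential fields. -/
structure ExpEmbedding (F : Type u) (K : Type u) [ExponentialField F] [ExponentialField K]
    extends F →+* K where
  map_expo : ∀ a : F, toFun (expo a) = expo (toFun a)

instance {F : Type u} {K : Type u} [ExponentialField F] [ExponentialField K] :
    FunLike (ExpEmbedding F K) F K where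
  coe f := f.toRingHom
  coe_injective f g h := by
    obtain ⟨f, hf⟩ := f
    obtain ⟨g, hg⟩ := g
    have : f = g := DFunLike.coe_injective h
    subst this
    rfl

/-- An EA-field: an exponential field that is algebraically closed. -/
structure EAField : Type (u + 1) where
  carrier : Type u
  [expField : ExponentialField carrier]
  [algClosed : IsAlgClosed carrier]

attribute [instance] EAField.expField EAField.algClosed

/-- The category of EA-fields, with all embeddings of exponential fields as arrows. -/
instance : Category.{u} EAField.{u} where
  Hom F K := ExpEmbedding F.carrier K.carrier
  id F := ⟨RingHom.id F.carrier, fun _ => rfl⟩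
  comp f g := ⟨g.toRingHom.comp f.toRingHom, fun a =>
    (congrArg g.toFun (f.map_expo a)).trans (g.map_expo (f.toFun a))⟩

instance : ConcreteCategory EAField.{u} (fun F K => ExpEmbedding F.carrier K.carrier) where
  hom f := f
  ofHom f := f
  hom_ofHom _ := rfl
  ofHom_hom _ := rfl
  id_apply _ := rfl
  comp_apply _ _ _ := rfl

/-- The function symbols of the language `⟨+, ·, -, 0, 1, exp⟩` of exponential rings. -/
inductive ExpRingFunc : ℕ → Type
  | add : ExpRingFunc 2
  | mul : ExpRingFunc 2
  | neg : ExpRingFunc 1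
  | zero : ExpRingFunc 0
  | one : ExpRingFunc 0
  | exp : ExpRingFunc 1

/-- The language of exponential rings. -/
def expRingLanguage : FirstOrder.Language.{0, 0} := ⟨ExpRingFunc, fun _ => Empty⟩

/-- EA-fields as structures in the language of exponential rings. -/
instance (F : EAField.{u}) : expRingLanguage.Structure F.carrier where
  funMap {n} (s : ExpRingFunc n) :=
    match n, s with
    | _, .add => fun a => a 0 + a 1
    | _, .mul => fun a => a 0 * a 1
    | _, .neg => fun a => - a 0
    | _, .zero => fun _ => 0
    | _, .one => fun _ => 1
    | _, .exp => fun a => expo (a 0)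
  RelMap r := r.elim

/-! ### Field-theoretic algebraic independence and EA-independence -/

/-- `td(D / C)`: the transcendence degree of the field generated by `C ∪ D` over the field
generated by `C`. -/
noncomputable def td {F : Type u} [Field F] (D C : Set F) : Cardinal.{u} :=
  Algebra.trdeg (Subfield.closure C) (IntermediateField.adjoin (Subfield.closure C) D)

/-- Field-theoretic algebraic independence of `A` from `B` over `C`. -/
def TdIndep {F : Type u} [Field F] (A B C : Set F) : Prop :=
  ∀ D : Set F, D ⊆ A → D.Finite → td D (B ∪ C) = td D C

/-- `S` is an EA-subfield of the exponential field `F`. -/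
structure IsEASubfield {F : Type u} [ExponentialField F] (S : Subfield F) : Prop where
  expo_mem : ∀ a ∈ S, expo a ∈ S
  algClosed : IsAlgClosed S

/-- `⟨A⟩^EA`: the smallest EA-subfield of `F` that contains `A`. -/
def eaClosure {F : Type u} [ExponentialField F] (A : Set F) : Subfield F :=
  sInf {S : Subfield F | IsEASubfield S ∧ A ⊆ S}

theorem subset_eaClosure {F : Type u} [ExponentialField F] (A : Set F) :
    A ⊆ eaClosure A := fun _ ha => Subfield.mem_sInf.2 fun _ hS => hS.2 ha

theorem eaClosure_le {F : Type u} [ExponentialField F] {A : Set F} {S : Subfield F}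
    (hS : IsEASubfield S) (hA : A ⊆ S) : eaClosure A ≤ S := sInf_le ⟨hS, hA⟩

/-- In an EA-field, `eaClosure A` is an EA-subfield, so it is indeed the smallest one over `A`. -/
theorem isEASubfield_eaClosure {F : Type u} [ExponentialField F] [IsAlgClosed F] (A : Set F) :
    IsEASubfield (eaClosure A) := by
  refine ⟨fun a ha => Subfield.mem_sInf.2 fun S hS =>
    hS.1.expo_mem a (Subfield.mem_sInf.1 ha S hS), ?_⟩
  refine IsAlgClosed.of_exists_root _ fun p hp hirr => ?_
  obtain ⟨r, hr⟩ := IsAlgClosed.exists_aeval_eq_zero F p hirr.degree_pos.ne'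
  have hmem : r ∈ eaClosure A := by
    refine Subfield.mem_sInf.2 fun S hS => ?_
    have := hS.1.algClosed
    have hint : IsIntegral S r := by
      have h1 : IsIntegral (eaClosure A) r := ⟨p, hp, by rwa [Polynomial.aeval_def] at hr⟩
      obtain ⟨q, hq, hq0⟩ := h1
      refine ⟨q.map (Subfield.inclusion (eaClosure_le hS.1 hS.2)), hq.map _, ?_⟩
      rw [Polynomial.eval₂_map]
      exact hq0
    obtain ⟨y, hy⟩ := minpoly.mem_range_of_degree_eq_one S r
      (IsAlgClosed.degree_eq_one_of_irreducible S (minpoly.irreducible hint))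
    exact hy ▸ y.2
  refine ⟨⟨r, hmem⟩, ?_⟩
  have : algebraMap (eaClosure A) F (p.eval ⟨r, hmem⟩) = 0 := by
    rw [← Polynomial.aeval_algebraMap_apply_eq_algebraMap_eval]
    exact hr
  exact (map_eq_zero _).1 this

/-- EA-independence of `A` from `B` over `C` in the EA-field `F`. -/
def EAIndep (F : EAField.{u}) (A B C : Set F.carrier) : Prop :=
  TdIndep (eaClosure (A ∪ C) : Set F.carrier) (eaClosure (B ∪ C)) (eaClosure C)

end ExpFields

/-! The field theory rests on one specialisation argument, an algebraic form of "independent over a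
model implies finitely satisfiable in it". If `A` is algebraically disjoint from `B` over an
algebraically closed `C`, the relative algebraic closure of the compositum of `A` and `B` maps to an
ultrapower of `B`, with `B` embedded diagonally and `A` sent into the ultrapower of `C`
(`AlgDisjoint.exists_specialization`). An equation between elements algebraic over `A` and `B` can
then be read in a single coordinate, where the elements of `A` have become elements of `C`. This
gives linear disjointness, `A ⊓ B ≤ C`, and the decisive statement `AlgDisjoint.exists_add_eq`: an
element of `B` that is a sum of one element algebraic over `A ⊔ P` and one algebraic over `A ⊔ Q`
already lies in `P + Q`. Ultrapowers also provide free amalgams of fields.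

Exponential maps are easy to extend: the unit group of an algebraically closed field is divisible,
so any homomorphism into it from a subgroup of the additive group extends. To amalgamate EA-fields
one therefore amalgamates the fields and checks that the given exponentials agree on all additive
relations between the pieces. In a free amalgam the only such relations come from the base. In a
3-amalgam, `exists_three_amalgam` shows that every relation `x + y + z = 0` has the form `(r + s) +
(t - r) + (-s - t) = 0` with `r`, `s`, `t` in the three smaller fields, and the exponentials cancel.

Local character is a countable closing-off argument, using that EA-closure is finitary and preserves
countability. Base monotonicity fails because a product of an element of `A` and an element of `D`
can be given any nonzero exponential value: if no nonzero integer multiple of it lies in `A + B`,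
its exponential may be chosen in `B` and transcendental over `D`. -/

/-! ### Ultrapowers of fields -/

namespace Ultrapower

open Filter

variable {I : Type w} (U : Ultrafilter I)

/-- The diagonal embedding into an ultrapower. -/
noncomputable def diag (B : Type u) [Field B] : B →+* Germ (U : Filter I) B :=
  (Germ.coeRingHom (U : Filter I)).comp (Pi.constRingHom I B)

/-- The embedding of ultrapowers induced by an embedding of fields. -/
noncomputable def mapHom {C : Type u} {B : Type v} [Field C] [Field B] (f : C →+* B) :
    Germ (U : Filter I) C →+* Germ (U : Filter I) B where
  toFun := Germ.map f
  map_one' := by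
    rw [← Germ.coe_one, Germ.map_coe, ← Germ.coe_one]; congr 1; ext; simp
  map_zero' := by
    rw [← Germ.coe_zero, Germ.map_coe, ← Germ.coe_zero]; congr 1; ext; simp
  map_add' a b := by
    induction a, b using Germ.inductionOn₂ with
    | _ a b =>
      rw [← Germ.coe_add, Germ.map_coe, Germ.map_coe, Germ.map_coe, ← Germ.coe_add]
      congr 1; ext; simp
  map_mul' a b := by
    induction a, b using Germ.inductionOn₂ with
    | _ a b =>
      rw [← Germ.coe_mul, Germ.map_coe, Germ.map_coe, Germ.map_coe, ← Germ.coe_mul]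
      congr 1; ext; simp

theorem mapHom_coe {C : Type u} {B : Type v} [Field C] [Field B] (f : C →+* B) (g : I → C) :
    mapHom U f (g : Germ (U : Filter I) C) = ((fun i => f (g i) : I → B) : Germ _ B) := rfl

theorem mapHom_diag {C : Type u} {B : Type v} [Field C] [Field B] (f : C →+* B) (c : C) :
    mapHom U f (diag U C c) = diag U B (f c) := rfl

/-- Łoś's theorem by hand: lift the coefficients of a monic polynomial to sequences and take a root
in every coordinate. -/
instance isAlgClosed (B : Type u) [Field B] [IsAlgClosed B] :
    IsAlgClosed (Germ (U : Filter I) B) := by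
  refine IsAlgClosed.of_exists_root _ fun p hp hirr => ?_
  have hdeg : p.natDegree ≠ 0 := hirr.natDegree_pos.ne'
  choose c hc using fun n => Quotient.exists_rep (p.coeff n)
  replace hc : ∀ n, ((c n : I → B) : Germ (U : Filter I) B) = p.coeff n := hc
  have hroot : ∀ i, ∃ r : B, r ^ p.natDegree +
      ∑ k ∈ Finset.range p.natDegree, c k i * r ^ k = 0 := by
    intro i
    -- The leading coefficient is put in as `1` in every coordinate, so that the degree never drops.
    let q : Polynomial B := Polynomial.X ^ p.natDegree +
      ∑ k ∈ Finset.range p.natDegree, Polynomial.C (c k i) * Polynomial.X ^ k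
    have hq : q.degree = p.natDegree := by
      apply Polynomial.degree_eq_of_le_of_coeff_ne_zero
      · refine (Polynomial.degree_add_le _ _).trans (max_le (Polynomial.degree_X_pow_le _) ?_)
        refine (Polynomial.degree_sum_le _ _).trans (Finset.sup_le fun k hk => ?_)
        refine (Polynomial.degree_C_mul_X_pow_le _ _).trans ?_
        exact_mod_cast (Finset.mem_range.1 hk).le
      · simp only [q, Polynomial.coeff_add, Polynomial.coeff_X_pow, if_true,
          Polynomial.finsetSum_coeff, Polynomial.coeff_C_mul]
        rw [Finset.sum_eq_zero]
        · simp
        · intro k hk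
          simp [(Finset.mem_range.1 hk).ne']
    obtain ⟨r, hr⟩ := IsAlgClosed.exists_root q (by rw [hq]; exact_mod_cast hdeg)
    refine ⟨r, ?_⟩
    simpa [q, Polynomial.IsRoot, Polynomial.eval_finsetSum] using hr
  choose r hr using hroot
  refine ⟨(r : Germ (U : Filter I) B), ?_⟩
  rw [Polynomial.eval_eq_sum_range, Finset.sum_range_succ, hp.coeff_natDegree, one_mul, add_comm]
  simp_rw [← hc]
  have : Germ.coeRingHom (U : Filter I) (r ^ p.natDegree +
      ∑ k ∈ Finset.range p.natDegree, c k * r ^ k) = 0 := by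
    have h0 : r ^ p.natDegree + ∑ k ∈ Finset.range p.natDegree, c k * r ^ k = 0 := by
      ext i
      simpa using hr i
    rw [h0, map_zero]
  simpa [map_add, map_sum, map_mul, map_pow] using this

instance charZero (B : Type u) [Field B] [CharZero B] : CharZero (Germ (U : Filter I) B) :=
  charZero_of_injective_ringHom (diag U B).injective

/-- A ring hom from a subring generated by `s`, over an algebraically closed field. -/
theorem exists_algHom_of_finite (C : Type u) (A : Type v) [Field C] [IsAlgClosed C] [Field A]
    [Algebra C A] (s : Finset A) : Nonempty (Algebra.adjoin C (s : Set A) →ₐ[C] C) := by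
  set R := Algebra.adjoin C (s : Set A)
  have : Algebra.FiniteType C R :=
    (Subalgebra.fg_iff_finiteType _).1 (Subalgebra.fg_adjoin_finset s)
  obtain ⟨m, hm⟩ := Ideal.exists_maximal R
  let := Ideal.Quotient.field m
  have : Algebra.FiniteType C (R ⧸ m) :=
    Algebra.FiniteType.of_surjective (Ideal.Quotient.mkₐ C m) (Ideal.Quotient.mkₐ_surjective C m)
  -- Zariski's lemma: the residue field is finite over `C`, hence embeds in `C`.
  have := finite_of_finite_type_of_isJacobsonRing C (R ⧸ m)
  have : Algebra.IsAlgebraic C (R ⧸ m) := Algebra.IsAlgebraic.of_finite C (R ⧸ m)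
  have hl : ∀ (K : Type v) [Field K] [Algebra C K] [Algebra.IsAlgebraic C K],
      Nonempty (K →ₐ[C] C) := fun K => ⟨IsAlgClosed.lift⟩
  exact ⟨(hl (R ⧸ m)).some.comp (Ideal.Quotient.mkₐ C m)⟩

/-- Every extension of an algebraically closed field embeds in an ultrapower of it. -/
theorem exists_hom (C A : Type u) [Field C] [IsAlgClosed C] [Field A] [Algebra C A] :
    ∃ (I : Type u) (U : Ultrafilter I) (h : A →+* Germ (U : Filter I) C),
      ∀ c, h (algebraMap C A c) = diag U C c := by
  classical
  have φ := fun s : Finset A => (exists_algHom_of_finite C A s).some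
  -- Any given `a` lies in `C[s]` for almost all `s`, so the default value `0` in `g` does not
  -- affect the germ.
  let U : Ultrafilter (Finset A) := Ultrafilter.of atTop
  have hU : (U : Filter (Finset A)) ≤ atTop := Ultrafilter.of_le atTop
  let g : A → Finset A → C := fun a s =>
    if h : a ∈ Algebra.adjoin C (s : Set A) then φ s ⟨a, h⟩ else 0
  have hmem : ∀ a : A, ∀ᶠ s : Finset A in (U : Filter (Finset A)), a ∈ Algebra.adjoin C (s : Set A) := by
    intro a
    refine hU ((eventually_ge_atTop {a}).mono fun s hs => ?_)
    exact Algebra.subset_adjoin (hs (Finset.mem_singleton_self a))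
  refine ⟨Finset A, U,
    { toFun := fun a => (g a : Germ (U : Filter (Finset A)) C)
      map_one' := ?_, map_zero' := ?_, map_add' := ?_, map_mul' := ?_ }, ?_⟩
  · refine Germ.coe_eq.2 (Eventually.of_forall fun s => ?_)
    simp only [g, dif_pos (one_mem (Algebra.adjoin C (s : Set A)))]
    exact map_one (φ s)
  · intro a b
    refine Germ.coe_eq.2 ?_
    filter_upwards [hmem a, hmem b] with s ha hb
    simp only [g, dif_pos ha, dif_pos hb, dif_pos (mul_mem ha hb)]
    exact map_mul (φ s) ⟨a, ha⟩ ⟨b, hb⟩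
  · refine Germ.coe_eq.2 (Eventually.of_forall fun s => ?_)
    simp only [g, dif_pos (zero_mem (Algebra.adjoin C (s : Set A)))]
    exact map_zero (φ s)
  · intro a b
    refine Germ.coe_eq.2 ?_
    filter_upwards [hmem a, hmem b] with s ha hb
    simp only [g, dif_pos ha, dif_pos hb, dif_pos (add_mem ha hb)]
    exact map_add (φ s) ⟨a, ha⟩ ⟨b, hb⟩
  · intro c
    refine Germ.coe_eq.2 (Eventually.of_forall fun s => ?_)
    simp only [g, dif_pos (Subalgebra.algebraMap_mem (Algebra.adjoin C (s : Set A)) c)]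
    exact (φ s).commutes c

/-- Elements of `B` that are linearly independent over `C` are linearly independent over the
ultrapower of `C`. -/
theorem eq_zero_of_sum_diag_mul {C : Type u} {B : Type v} [Field C] [Field B] [Algebra C B]
    {ι : Type*} {b : ι → B} (hb : LinearIndependent C b) (s : Finset ι)
    (g : ι → Germ (U : Filter I) C)
    (h : ∑ i ∈ s, diag U B (b i) * mapHom U (algebraMap C B) (g i) = 0) :
    ∀ i ∈ s, g i = 0 := by
  choose f hf using fun i => Quotient.exists_rep (g i)
  replace hf : ∀ i, ((f i : I → C) : Germ (U : Filter I) C) = g i := hf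
  have h1 : Germ.coeRingHom (U : Filter I)
      (∑ i ∈ s, (fun _ => b i : I → B) * (fun k => algebraMap C B (f i k) : I → B)) = 0 := by
    rw [map_sum, ← h]
    refine Finset.sum_congr rfl fun i _ => ?_
    rw [map_mul, ← hf, mapHom_coe]
    rfl
  -- In almost every coordinate this is a linear relation between the `b i` with coefficients in
  -- `C`.
  have h2 : ∀ᶠ k in (U : Filter I), ∑ i ∈ s, b i * algebraMap C B (f i k) = 0 := by
    have := Germ.coe_eq.1 (h1 : ((_ : I → B) : Germ (U : Filter I) B) = ((0 : I → B) : Germ _ B))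
    filter_upwards [this] with k hk
    simpa [Finset.sum_apply] using hk
  intro i hi
  rw [← hf]
  refine Germ.coe_eq.2 ?_
  filter_upwards [h2] with k hk
  refine linearIndependent_iff'.1 hb s (fun i => f i k) ?_ i hi
  rw [← hk]
  exact Finset.sum_congr rfl fun j _ => by rw [Algebra.smul_def, mul_comm]

/-- Elements of the ultrapower of `C` that are linearly independent over `C` are linearly
independent over `B`. -/
theorem eq_zero_of_sum_mul_diag {C : Type u} {B : Type v} [Field C] [Field B] [Algebra C B]
    {ι : Type*} {g : ι → Germ (U : Filter I) C} (s : Finset ι)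
    (hg : ∀ c : ι → C, ∑ i ∈ s, diag U C (c i) * g i = 0 → ∀ i ∈ s, c i = 0) (b : ι → B)
    (h : ∑ i ∈ s, diag U B (b i) * mapHom U (algebraMap C B) (g i) = 0) :
    ∀ i ∈ s, b i = 0 := by
  classical
  -- Expanding the `b i` in a basis of `B` over `C` turns the relation into one between basis
  -- elements; by the preceding lemma each coefficient vanishes, which is a relation over `C`
  -- between the `g i`.
  let e := Module.Basis.ofVectorSpace C B
  let T := s.biUnion fun i => (e.repr (b i)).support
  have hb : ∀ i ∈ s, b i = ∑ j ∈ T, e j * algebraMap C B (e.repr (b i) j) := by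
    intro i hi
    conv_lhs => rw [← e.linearCombination_repr (b i), Finsupp.linearCombination_apply]
    rw [Finsupp.sum_of_support_subset (s := T) _
      (Finset.subset_biUnion_of_mem (fun i => (e.repr (b i)).support) hi) _ (by simp)]
    exact Finset.sum_congr rfl fun j _ => by rw [Algebra.smul_def, mul_comm]
  have h1 : ∑ j ∈ T, diag U B (e j) * mapHom U (algebraMap C B)
      (∑ i ∈ s, diag U C (e.repr (b i) j) * g i) = 0 := by
    rw [← h]
    simp_rw [map_sum, map_mul, mapHom_diag, Finset.mul_sum]
    rw [Finset.sum_comm]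
    refine Finset.sum_congr rfl fun i hi => ?_
    conv_rhs => rw [hb i hi, map_sum, Finset.sum_mul]
    refine Finset.sum_congr rfl fun j _ => ?_
    rw [map_mul, mul_assoc]
  have h2 := eq_zero_of_sum_diag_mul U e.linearIndependent T _ h1
  intro i hi
  rw [hb i hi]
  refine Finset.sum_eq_zero fun j hj => ?_
  rw [hg (fun i => e.repr (b i) j) (h2 j hj) i hi, map_zero, mul_zero]

/-- A family in the ultrapower of `C` that is algebraically independent over `C` is
algebraically independent over `B`. -/
theorem injective_eval₂_mapHom {C : Type u} {B : Type v} [Field C] [Field B] [Algebra C B]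
    {ι : Type*} (g : ι → Germ (U : Filter I) C)
    (hg : Function.Injective (MvPolynomial.eval₂Hom (diag U C) g)) :
    Function.Injective (MvPolynomial.eval₂Hom (diag U B)
      fun i => mapHom U (algebraMap C B) (g i)) := by
  refine (injective_iff_map_eq_zero _).2 fun p hp => ?_
  rw [MvPolynomial.coe_eval₂Hom, MvPolynomial.eval₂_eq] at hp
  -- Algebraic independence is linear independence of the monomials.
  have key := eq_zero_of_sum_mul_diag U (B := B) (g := fun d : ι →₀ ℕ => ∏ i ∈ d.support, g i ^ d i)
    p.support ?_ (fun d => p.coeff d) ?_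
  · ext d
    by_cases hd : d ∈ p.support
    · simpa using key d hd
    · simpa using hd
  · intro c hc d hd
    let q : MvPolynomial ι C := ∑ d ∈ p.support, MvPolynomial.monomial d (c d)
    have hq : q = 0 := by
      apply hg
      rw [map_zero, ← hc, map_sum]
      refine Finset.sum_congr rfl fun d _ => ?_
      rw [MvPolynomial.coe_eval₂Hom, MvPolynomial.eval₂_monomial]
      rfl
    have := congrArg (MvPolynomial.coeff d) hq
    classical
    simpa [q, MvPolynomial.coeff_sum, MvPolynomial.coeff_monomial, hd] using this
  · simpa [map_prod, map_pow] using hp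

end Ultrapower

/-! ### Algebraic disjointness of subfields -/

/-- `A` is algebraically disjoint from `B` over `C`: algebraic independence over `C` of subsets
of `A` passes to `B`. -/
def AlgDisjoint {F : Type u} [Field F] (A B C : Subfield F) : Prop :=
  ∀ S : Set F, S ⊆ A → AlgebraicIndependent C ((↑) : S → F) →
    AlgebraicIndependent B ((↑) : S → F)

/-- The subfield of the elements that are algebraic over `R`. -/
def algSubfield (R : Type v) (F : Type u) [CommRing R] [IsDomain R] [Field F] [Algebra R F] :
    Subfield F where
  __ := (Subalgebra.algebraicClosure R F).toSubring
  inv_mem' _ hx := IsAlgebraic.inv hx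

theorem mem_algSubfield_of_isAlgebraic {R : Type v} {F : Type u} [CommRing R] [IsDomain R]
    [Field F] [Algebra R F] {x : F} (hx : IsAlgebraic (algSubfield R F) x) :
    x ∈ algSubfield R F := by
  have : IsAlgebraic (Subalgebra.algebraicClosure R F) x :=
    hx.ringHom_of_comp_eq (RingHom.id (algSubfield R F)) (RingHom.id F)
      (S := Subalgebra.algebraicClosure R F) (fun _ _ h => h) rfl
  exact this.restrictScalars R

theorem exists_algSubfield_lift {R : Type v} {F : Type u} {L : Type w} [CommRing R] [IsDomain R]
    [Field F] [Algebra R F] [FaithfulSMul R F] [Field L] [IsAlgClosed L] (g : R →+* L)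
    (hg : Function.Injective g) : ∃ Ψ : algSubfield R F →+* L,
      ∀ r, Ψ ⟨algebraMap R F r, isAlgebraic_algebraMap r⟩ = g r := by
  let := g.toAlgebra
  have : FaithfulSMul R L := (faithfulSMul_iff_algebraMap_injective R L).2 hg
  let ψ : Subalgebra.algebraicClosure R F →ₐ[R] L := IsAlgClosed.lift
  exact ⟨{ toFun := fun x => ψ ⟨x, x.2⟩
           map_one' := map_one ψ
           map_zero' := map_zero ψ
           map_add' := fun x y => map_add ψ ⟨x, x.2⟩ ⟨y, y.2⟩
           map_mul' := fun x y => map_mul ψ ⟨x, x.2⟩ ⟨y, y.2⟩ }, ψ.commutes⟩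

section Subfields

variable {F : Type u} [Field F]

theorem IsAlgebraic.of_subfield_le {C D : Subfield F} (h : C ≤ D) {x : F}
    (hx : IsAlgebraic C x) : IsAlgebraic D x :=
  hx.ringHom_of_comp_eq (Subfield.inclusion h) (RingHom.id F) (Subfield.inclusion h).injective rfl

theorem AlgebraicIndependent.of_subfield_le {ι : Type*} {C D : Subfield F} (h : C ≤ D)
    {x : ι → F} (hx : AlgebraicIndependent D x) : AlgebraicIndependent C x :=
  AlgebraicIndependent.of_ringHom_of_comp_eq (Subfield.inclusion h) (RingHom.id F)
    (x := x) hx (Subfield.inclusion h).injective rfl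

theorem AlgDisjoint.mono_right {A B B' C : Subfield F} (h : AlgDisjoint A B C) (hB : B' ≤ B) :
    AlgDisjoint A B' C := fun S hS hi => (h S hS hi).of_subfield_le hB

theorem AlgDisjoint.algebraicIndependent {A B C : Subfield F} (h : AlgDisjoint A B C)
    {ι : Type*} {x : ι → F} (hx : ∀ i, x i ∈ A) (hi : AlgebraicIndependent C x) :
    AlgebraicIndependent B x := by
  have h1 := h (Set.range x) (by rintro _ ⟨i, rfl⟩; exact hx i) hi.coe_range
  have h2 := h1.comp (Set.rangeFactorization x) (fun i j hij => hi.injective congr($hij.1))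
  exact h2

theorem exists_algebraicIndependent_subset (A C : Subfield F) :
    ∃ S : Set F, S ⊆ A ∧ AlgebraicIndependent C ((↑) : S → F) ∧
      ∀ a ∈ A, IsAlgebraic (Algebra.adjoin C S) a := by
  obtain ⟨S, -, hS⟩ := exists_maximal_algebraicIndependent (R := C) (∅ : Set F) A
    (Set.empty_subset _) algebraicIndependent_empty
  refine ⟨S, hS.prop.2, hS.prop.1, fun a ha => ?_⟩
  by_contra hna
  by_cases haS : a ∈ S
  · exact hna (isAlgebraic_algebraMap (⟨a, Algebra.subset_adjoin haS⟩ : Algebra.adjoin C S))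
  · have h1 : AlgebraicIndepOn C id (insert a S) := by
      refine (AlgebraicIndepOn.insert_iff haS).2 ⟨hS.prop.1, ?_⟩
      rwa [Set.image_id]
    exact haS (hS.le_of_ge ⟨h1, Set.insert_subset ha hS.prop.2⟩ (Set.subset_insert a S)
      (Set.mem_insert a S))

/-- If `A` is algebraically disjoint from `B` over `C` and `C ≤ D ≤ B`, then algebraic
independence over `D` of families in `B` passes to fields algebraic over `D ⊔ A`. -/
theorem AlgDisjoint.algebraicIndependent_of_isAlgebraic {A B C D E : Subfield F}
    (h : AlgDisjoint A B C) (hCD : C ≤ D) (hDB : D ≤ B) {ι : Type*} {x : ι → F}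
    (hxB : ∀ i, x i ∈ B) (hx : AlgebraicIndependent D x)
    (hE : ∀ y ∈ E, IsAlgebraic (D ⊔ A : Subfield F) y) : AlgebraicIndependent E x := by
  obtain ⟨S, hSA, hSi, hSalg⟩ := exists_algebraicIndependent_subset A C
  have hSB := h S hSA hSi
  let X := Algebra.adjoin D (Set.range x)
  have hXB : ∀ y ∈ X, y ∈ B := fun y hy => by
    induction hy using Algebra.adjoin_induction with
    | mem y hy => obtain ⟨i, rfl⟩ := hy; exact hxB i
    | algebraMap r => exact hDB r.2
    | add _ _ _ _ h1 h2 => exact add_mem h1 h2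
    | mul _ _ _ _ h1 h2 => exact mul_mem h1 h2
  let j : X →+* B :=
    { toFun := fun y => ⟨y, hXB y y.2⟩
      map_one' := rfl, map_zero' := rfl, map_add' := fun _ _ => rfl, map_mul' := fun _ _ => rfl }
  have hSX : AlgebraicIndependent X ((↑) : S → F) :=
    AlgebraicIndependent.of_ringHom_of_comp_eq (x := ((↑) : S → F)) j (RingHom.id F)
      hSB (fun a b hab => Subtype.ext congr(($hab).1)) rfl
  -- Exchange: `x` is independent over `D` and `S` over `D[x]`, so both together are independent
  -- over `D`; hence `x` is independent over `D[S]` and over its algebraic closure.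
  have h1 : AlgebraicIndependent D (Sum.elim ((↑) : S → F) x) := hx.sumElim hSX
  have h2 : AlgebraicIndependent D (Sum.elim x ((↑) : S → F)) := by
    refine (algebraicIndependent_equiv' (Equiv.sumComm _ _) ?_).1 h1
    ext (i | i) <;> rfl
  have h3 := (AlgebraicIndependent.sumElim_iff.1 h2).2.subalgebraAlgebraicClosure
  rw [Subtype.range_coe] at h3
  let W := algSubfield (Algebra.adjoin D S) F
  have hDW : D ≤ W := fun d hd =>
    isAlgebraic_algebraMap (⟨d, Subalgebra.algebraMap_mem _ (⟨d, hd⟩ : D)⟩ : Algebra.adjoin D S)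
  have hSW : ∀ s ∈ S, s ∈ W := fun s hs =>
    isAlgebraic_algebraMap (⟨s, Algebra.subset_adjoin hs⟩ : Algebra.adjoin D S)
  have hCSW : ∀ y ∈ Algebra.adjoin C S, y ∈ W := fun y hy => by
    induction hy using Algebra.adjoin_induction with
    | mem y hy => exact hSW y hy
    | algebraMap r => exact hDW (hCD r.2)
    | add _ _ _ _ h1 h2 => exact add_mem h1 h2
    | mul _ _ _ _ h1 h2 => exact mul_mem h1 h2
  have hAW : A ≤ W := fun a ha => by
    refine mem_algSubfield_of_isAlgebraic ?_
    let k : Algebra.adjoin C S →+* W :=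
      { toFun := fun y => ⟨y, hCSW y y.2⟩
        map_one' := rfl, map_zero' := rfl, map_add' := fun _ _ => rfl
        map_mul' := fun _ _ => rfl }
    exact (hSalg a ha).ringHom_of_comp_eq k (RingHom.id F)
      (fun a b hab => Subtype.ext congr(($hab).1)) rfl
  have hEW : E ≤ W := fun y hy =>
    mem_algSubfield_of_isAlgebraic ((hE y hy).of_subfield_le (sup_le hDW hAW))
  have h4 : AlgebraicIndependent W x :=
    AlgebraicIndependent.of_ringHom_of_comp_eq (x := x) (S := Subalgebra.algebraicClosure _ F)
      (RingHom.id W) (RingHom.id F) h3 (fun _ _ h => h) rfl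
  exact h4.of_subfield_le hEW

theorem AlgDisjoint.symm {A B C : Subfield F} (h : AlgDisjoint A B C) (hCB : C ≤ B) :
    AlgDisjoint B A C := fun _ hS hi =>
  h.algebraicIndependent_of_isAlgebraic le_rfl hCB (fun s => hS s.2) hi
    fun y hy => isAlgebraic_algebraMap (⟨y, (le_sup_right : A ≤ C ⊔ A) hy⟩ : (C ⊔ A : Subfield F))

end Subfields

theorem mem_range_of_isAlgebraic {K : Type u} {L : Type v} [Field K] [IsAlgClosed K] [Field L]
    [Algebra K L] {x : L} (hx : IsAlgebraic K x) : x ∈ Set.range (algebraMap K L) :=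
  minpoly.mem_range_of_degree_eq_one K x
    (IsAlgClosed.degree_eq_one_of_irreducible K (minpoly.irreducible hx.isIntegral))

theorem Subfield.mem_of_isAlgebraic {F : Type u} [Field F] {C : Subfield F} (hC : IsAlgClosed C)
    {x : F} (hx : IsAlgebraic C x) : x ∈ C := by
  obtain ⟨y, rfl⟩ := mem_range_of_isAlgebraic hx
  exact y.2

/-- Pulling back an algebraically closed field along a homomorphism that is defined on a relatively
algebraically closed subfield yields a relatively algebraically closed subfield. -/
theorem mem_map_comap_of_isAlgebraic {F : Type u} {K : Type v} {L : Type w} [Field F] [Field K]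
    [Field L] [IsAlgClosed K] {E : Subfield F} (hE : ∀ x, IsAlgebraic E x → x ∈ E)
    (Ψ : E →+* L) (f : K →+* L) {x : F}
    (hx : IsAlgebraic ((f.fieldRange.comap Ψ).map E.subtype) x) :
    ∃ h : x ∈ E, Ψ ⟨x, h⟩ ∈ Set.range f := by
  have hTE : (f.fieldRange.comap Ψ).map E.subtype ≤ E := by
    rintro _ ⟨y, -, rfl⟩
    exact y.2
  have hxE := hE x (hx.of_subfield_le hTE)
  refine ⟨hxE, ?_⟩
  have key : ∀ t : (f.fieldRange.comap Ψ).map E.subtype, ∃ k, f k = Ψ (Subfield.inclusion hTE t) := by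
    rintro ⟨_, y, ⟨k, hk⟩, rfl⟩
    exact ⟨k, hk⟩
  choose θ hθ using key
  let θ' : (f.fieldRange.comap Ψ).map E.subtype →+* K :=
    { toFun := θ
      map_one' := f.injective (by rw [hθ, map_one, map_one, map_one])
      map_zero' := f.injective (by rw [hθ, map_zero, map_zero, map_zero])
      map_add' := fun a b => f.injective (by rw [hθ, map_add, map_add, map_add, hθ, hθ])
      map_mul' := fun a b => f.injective (by rw [hθ, map_mul, map_mul, map_mul, hθ, hθ]) }
  -- The polynomial is moved to `K` along `θ'`; then `Ψ x` is algebraic over the algebraically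
  -- closed image of `K`.
  obtain ⟨p, hp, hpx⟩ := hx
  let := f.toAlgebra
  refine mem_range_of_isAlgebraic ⟨p.map θ', (Polynomial.map_ne_zero_iff θ'.injective).2 hp, ?_⟩
  have h2 : f.comp θ' = Ψ.comp (Subfield.inclusion hTE) := RingHom.ext hθ
  have h3 : Polynomial.eval₂ (Subfield.inclusion hTE) ⟨x, hxE⟩ p = 0 := by
    apply E.subtype.injective
    rw [Polynomial.hom_eval₂, map_zero]
    exact hpx
  have h4 := congrArg Ψ h3
  rw [Polynomial.hom_eval₂, map_zero, ← h2] at h4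
  rw [Polynomial.aeval_def, Polynomial.eval₂_map]
  exact h4

/-! ### Specialisation into an ultrapower -/

/-- If `A` is algebraically disjoint from `B` over `C`, then the relative algebraic closure of
`A` and `B` maps to an ultrapower of `B`, with `B` embedded diagonally and `A` sent to the
ultrapower of `C`. -/
theorem AlgDisjoint.exists_specialization {F : Type u} [Field F] {A B C : Subfield F}
    (h : AlgDisjoint A B C) (hCA : C ≤ A) (hCB : C ≤ B) (hC : IsAlgClosed C)
    (hB : IsAlgClosed B) :
    ∃ (I : Type u) (U : Ultrafilter I) (E : Subfield F)
      (Ψ : E →+* Filter.Germ (U : Filter I) B), A ≤ E ∧ (∀ x, IsAlgebraic E x → x ∈ E) ∧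
      (∀ b : B, ∃ hb : (b : F) ∈ E, Ψ ⟨b, hb⟩ = Ultrapower.diag U B b) ∧
      ∀ a (ha : a ∈ E), a ∈ A →
        Ψ ⟨a, ha⟩ ∈ Set.range (Ultrapower.mapHom U (Subfield.inclusion hCB)) := by
  obtain ⟨S, hSA, hSi, hSalg⟩ := exists_algebraicIndependent_subset A C
  have hSB := h S hSA hSi
  let := (Subfield.inclusion hCA).toAlgebra
  let algCB := (Subfield.inclusion hCB).toAlgebra
  obtain ⟨I, U, φ, hφ⟩ := Ultrapower.exists_hom C A
  let R := MvPolynomial S B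
  let algF : Algebra R F := (MvPolynomial.aeval ((↑) : S → F) : R →ₐ[B] F).toRingHom.toAlgebra
  let s' : S → A := fun s => ⟨s, hSA s.2⟩
  have hS' : Function.Injective (MvPolynomial.eval₂Hom (Ultrapower.diag U C) fun s => φ (s' s)) := by
    have h1 : MvPolynomial.eval₂Hom (Ultrapower.diag U C) (fun s => φ (s' s)) =
        φ.comp (MvPolynomial.aeval s' : MvPolynomial S C →ₐ[C] A).toRingHom := by
      ext i
      · simp [hφ]
      · simp
    rw [h1, RingHom.coe_comp]
    refine φ.injective.comp ?_
    exact AlgebraicIndependent.of_ringHom_of_comp_eq (R := C) (x := s') (S := C) (RingHom.id C)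
      A.subtype hSi (fun _ _ h => h) rfl
  -- The elements of `S` go to their images under `φ`, which stay independent over `B`. So `γ` is
  -- injective and extends to the elements algebraic over `B[S]`, an ultrapower of `B` being
  -- algebraically closed.
  let γ : R →+* Filter.Germ (U : Filter I) B :=
    MvPolynomial.eval₂Hom (Ultrapower.diag U B) fun s =>
      Ultrapower.mapHom U (algebraMap C B) (φ (s' s))
  have hF : Function.Injective (algebraMap R F) := hSB
  have : FaithfulSMul R F := (faithfulSMul_iff_algebraMap_injective R F).2 hF
  let E := algSubfield R F
  obtain ⟨Ψ, hΨ⟩ := exists_algSubfield_lift (F := F) γ (Ultrapower.injective_eval₂_mapHom U _ hS')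
  have hR : ∀ r : R, ∃ hr : algebraMap R F r ∈ E, Ψ ⟨algebraMap R F r, hr⟩ = γ r :=
    fun r => ⟨isAlgebraic_algebraMap r, hΨ r⟩
  have hEB : ∀ b : B, ∃ hb : (b : F) ∈ E, Ψ ⟨b, hb⟩ = Ultrapower.diag U B b := by
    intro b
    obtain ⟨hr, hr'⟩ := hR (MvPolynomial.C b)
    have e1 : algebraMap R F (MvPolynomial.C b) = b := MvPolynomial.aeval_C _ _
    have e2 : γ (MvPolynomial.C b) =
      Ultrapower.diag U B b := MvPolynomial.eval₂Hom_C _ _ _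
    simp_rw [e1] at hr hr'
    exact ⟨hr, hr'.trans e2⟩
  have hES : ∀ s : S, ∃ hs : (s : F) ∈ E,
      Ψ ⟨s, hs⟩ = Ultrapower.mapHom U (algebraMap C B) (φ (s' s)) := by
    intro s
    obtain ⟨hr, hr'⟩ := hR (MvPolynomial.X s)
    have e1 : algebraMap R F (MvPolynomial.X s) = s := MvPolynomial.aeval_X _ _
    have e2 : γ (MvPolynomial.X s) =
      Ultrapower.mapHom U (algebraMap C B) (φ (s' s)) := MvPolynomial.eval₂Hom_X' _ _ _
    simp_rw [e1] at hr hr'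
    exact ⟨hr, hr'.trans e2⟩
  have hEE : ∀ x, IsAlgebraic E x → x ∈ E := fun x hx => mem_algSubfield_of_isAlgebraic hx
  let T := ((Ultrapower.mapHom U (algebraMap C B)).fieldRange.comap Ψ).map E.subtype
  have hCT : C ≤ T := fun c hc => by
    obtain ⟨hb, hb'⟩ := hEB (algebraMap C B ⟨c, hc⟩)
    exact ⟨⟨c, hb⟩, ⟨Ultrapower.diag U C ⟨c, hc⟩, hb'.symm⟩, rfl⟩
  have hST : ∀ s ∈ S, s ∈ T := fun s hs => by
    obtain ⟨hb, hb'⟩ := hES ⟨s, hs⟩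
    exact ⟨⟨s, hb⟩, ⟨_, hb'.symm⟩, rfl⟩
  have hCST : ∀ y ∈ Algebra.adjoin C S, y ∈ T := fun y hy => by
    induction hy using Algebra.adjoin_induction with
    | mem y hy => exact hST y hy
    | algebraMap r => exact hCT r.2
    | add _ _ _ _ h1 h2 => exact add_mem h1 h2
    | mul _ _ _ _ h1 h2 => exact mul_mem h1 h2
  -- `Ψ` need not agree with `φ` on `A`. It suffices that it sends `C[S]` into the ultrapower of
  -- `C`, which is algebraically closed, and that `A` is algebraic over `C[S]`.
  have hAT : ∀ a ∈ A, ∃ h : a ∈ E,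
      Ψ ⟨a, h⟩ ∈ Set.range (Ultrapower.mapHom U (algebraMap C B)) := fun a ha => by
    refine mem_map_comap_of_isAlgebraic hEE Ψ _ ?_
    let k : Algebra.adjoin C S →+* T :=
      { toFun := fun y => ⟨y, hCST y y.2⟩
        map_one' := rfl, map_zero' := rfl, map_add' := fun _ _ => rfl
        map_mul' := fun _ _ => rfl }
    exact (hSalg a ha).ringHom_of_comp_eq k (RingHom.id F)
      (fun a b hab => Subtype.ext congr(($hab).1)) rfl
  exact ⟨I, U, E, Ψ, fun a ha => (hAT a ha).1, hEE, hEB, fun a _ ha => (hAT a ha).2⟩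

/-- In the situation of `AlgDisjoint.exists_specialization`, elements algebraic over `A ⊔ P` are
sent to the ultrapower of `P`, for each algebraically closed field `P` between `C` and `B`. -/
theorem AlgDisjoint.exists_specialization' {F : Type u} [Field F] {A B C : Subfield F}
    (h : AlgDisjoint A B C) (hCA : C ≤ A) (hCB : C ≤ B) (hC : IsAlgClosed C)
    (hB : IsAlgClosed B) :
    ∃ (I : Type u) (U : Ultrafilter I) (E : Subfield F)
      (Ψ : E →+* Filter.Germ (U : Filter I) B),
      (∀ b : B, ∃ hb : (b : F) ∈ E, Ψ ⟨b, hb⟩ = Ultrapower.diag U B b) ∧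
      ∀ (P : Subfield F), C ≤ P → ∀ hPB : P ≤ B, IsAlgClosed P →
        ∀ x, IsAlgebraic (A ⊔ P : Subfield F) x → ∃ h : x ∈ E,
          Ψ ⟨x, h⟩ ∈ Set.range (Ultrapower.mapHom U (Subfield.inclusion hPB)) := by
  obtain ⟨I, U, E, Ψ, hAE, hEE, hEB, hEA⟩ := h.exists_specialization hCA hCB hC hB
  refine ⟨I, U, E, Ψ, hEB, fun P hCP hPB hP x hx => ?_⟩
  refine mem_map_comap_of_isAlgebraic hEE Ψ _ (hx.of_subfield_le (sup_le ?_ ?_))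
  · intro a ha
    obtain ⟨c, hc⟩ := hEA a (hAE ha) ha
    refine ⟨⟨a, hAE ha⟩, ⟨Ultrapower.mapHom U (Subfield.inclusion hCP) c, ?_⟩, rfl⟩
    rw [← hc]
    induction c using Filter.Germ.inductionOn
    rfl
  · intro p hp
    obtain ⟨hb, hb'⟩ := hEB ⟨p, hPB hp⟩
    exact ⟨⟨p, hb⟩, ⟨Ultrapower.diag U P ⟨p, hp⟩, hb'.symm⟩, rfl⟩

/-- Let `A` be algebraically disjoint from `B` over `C`, and let `P` and `Q` be algebraically
closed fields between `C` and `B`. An element of `B` that is the sum of an element algebraic over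
`A ⊔ P` and one algebraic over `A ⊔ Q` belongs to `P + Q`. -/
theorem AlgDisjoint.exists_add_eq {F : Type u} [Field F] {A B C : Subfield F}
    (h : AlgDisjoint A B C) (hCA : C ≤ A) (hCB : C ≤ B) (hC : IsAlgClosed C)
    (hB : IsAlgClosed B) {P Q : Subfield F} (hCP : C ≤ P) (hPB : P ≤ B) (hP : IsAlgClosed P)
    (hCQ : C ≤ Q) (hQB : Q ≤ B) (hQ : IsAlgClosed Q) {x y : F}
    (hx : IsAlgebraic (A ⊔ P : Subfield F) x) (hy : IsAlgebraic (A ⊔ Q : Subfield F) y)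
    (hxy : x + y ∈ B) : ∃ p ∈ P, ∃ q ∈ Q, x + y = p + q := by
  obtain ⟨I, U, E, Ψ, hEB, hE⟩ := h.exists_specialization' hCA hCB hC hB
  obtain ⟨hxE, p, hp⟩ := hE P hCP hPB hP x hx
  obtain ⟨hyE, q, hq⟩ := hE Q hCQ hQB hQ y hy
  obtain ⟨hxyE, hxy'⟩ := hEB ⟨x + y, hxy⟩
  induction p using Filter.Germ.inductionOn with | _ p
  induction q using Filter.Germ.inductionOn with | _ q
  have h1 : Ultrapower.diag U B ⟨x + y, hxy⟩ =
      Ultrapower.mapHom U (Subfield.inclusion hPB) p +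
        Ultrapower.mapHom U (Subfield.inclusion hQB) q := by
    rw [← hxy', hp, hq, ← map_add]
    rfl
  -- Equality in the ultrapower holds in almost every coordinate, and a single coordinate provides
  -- the witnesses in `P` and `Q`.
  have h2 : (fun _ => ⟨x + y, hxy⟩ : I → B) =ᶠ[(U : Filter I)]
      fun i => Subfield.inclusion hPB (p i) + Subfield.inclusion hQB (q i) :=
    Filter.Germ.coe_eq.1 h1
  replace h2 := h2.exists
  obtain ⟨i, hi⟩ := h2
  exact ⟨p i, (p i).2, q i, (q i).2, congrArg Subtype.val hi⟩

/-- This is the preceding decomposition with `Q = P` and second summand `0`. -/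
theorem AlgDisjoint.mem_of_isAlgebraic {F : Type u} [Field F] {A B C : Subfield F}
    (h : AlgDisjoint A B C) (hCA : C ≤ A) (hCB : C ≤ B) (hC : IsAlgClosed C)
    (hB : IsAlgClosed B) {P : Subfield F} (hCP : C ≤ P) (hPB : P ≤ B) (hP : IsAlgClosed P)
    {x : F} (hx : IsAlgebraic (A ⊔ P : Subfield F) x) (hxB : x ∈ B) : x ∈ P := by
  obtain ⟨p, hp, q, hq, e⟩ := h.exists_add_eq hCA hCB hC hB hCP hPB hP hCP hPB hP hx
    (y := 0) isAlgebraic_zero (by simpa)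
  rw [add_zero] at e
  exact e ▸ add_mem hp hq

theorem AlgDisjoint.inf_le {F : Type u} [Field F] {A B C : Subfield F}
    (h : AlgDisjoint A B C) (hCA : C ≤ A) (hCB : C ≤ B) (hC : IsAlgClosed C)
    (hB : IsAlgClosed B) : A ⊓ B ≤ C := fun x hx =>
  h.mem_of_isAlgebraic hCA hCB hC hB le_rfl hCB hC (isAlgebraic_algebraMap
    (⟨x, (le_sup_left : A ≤ A ⊔ C) hx.1⟩ : (A ⊔ C : Subfield F))) hx.2

/-- Algebraically disjoint fields are linearly disjoint over an algebraically closed field. -/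
theorem AlgDisjoint.eq_zero_of_sum_mul_eq_zero {F : Type u} [Field F] {A B C : Subfield F}
    (h : AlgDisjoint A B C) (hCA : C ≤ A) (hCB : C ≤ B) (hC : IsAlgClosed C)
    (hB : IsAlgClosed B) {ι : Type*} {b : ι → F} (hb : LinearIndependent C b)
    (hbB : ∀ i, b i ∈ B) (s : Finset ι) (a : ι → F) (ha : ∀ i, a i ∈ A)
    (hab : ∑ i ∈ s, b i * a i = 0) : ∀ i ∈ s, a i = 0 := by
  obtain ⟨I, U, E, Ψ, hAE, hEE, hEB, hEA⟩ := h.exists_specialization hCA hCB hC hB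
  let := (Subfield.inclusion hCB).toAlgebra
  choose c hc using fun i => hEA (a i) (hAE (ha i)) (ha i)
  choose hbE hbE' using fun i => hEB ⟨b i, hbB i⟩
  have hb' : LinearIndependent C fun i => (⟨b i, hbB i⟩ : B) := by
    rw [linearIndependent_iff'] at hb ⊢
    intro s g hg
    refine hb s g ?_
    have := congrArg B.subtype hg
    rw [map_sum, map_zero] at this
    exact this
  -- Under `Ψ` the relation acquires diagonal `b i` and coefficients in the ultrapower of `C`.
  have h1 := Ultrapower.eq_zero_of_sum_diag_mul U hb' s c ?_
  · intro i hi
    have h2 := hc i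
    rw [h1 i hi, map_zero, eq_comm, map_eq_zero] at h2
    exact congrArg Subtype.val h2
  · have h2 : ∑ i ∈ s, (⟨b i, hbE i⟩ * ⟨a i, hAE (ha i)⟩ : E) = 0 := by
      apply E.subtype.injective
      rw [map_sum, map_zero]
      exact hab
    have h3 := congrArg Ψ h2
    rw [map_sum, map_zero] at h3
    rw [← h3]
    refine Finset.sum_congr rfl fun i _ => ?_
    rw [map_mul, hbE', ← hc]
    rfl

/-! ### Free amalgams of fields -/

theorem algebraicIndependent_fieldRange_iff {K : Type u} {L : Type v} [Field K] [Field L]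
    (k : K →+* L) {ι : Type*} (x : ι → L) : AlgebraicIndependent k.fieldRange x ↔
      Function.Injective (MvPolynomial.eval₂Hom k x) := by
  let := k.toAlgebra
  have h1 : Function.Injective (MvPolynomial.eval₂Hom k x) ↔ AlgebraicIndependent K x := Iff.rfl
  rw [h1]
  exact ⟨fun h => AlgebraicIndependent.of_ringHom_of_comp_eq (x := x) k.rangeRestrictField
      (RingHom.id L) h k.rangeRestrictField.injective rfl,
    fun h => AlgebraicIndependent.ringHom_of_comp_eq k.rangeRestrictField
      (RingHom.id L) h k.rangeRestrictField_bijective.2 Function.injective_id rfl⟩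

theorem RingHom.isAlgClosed_fieldRange {K : Type u} {L : Type v} [Field K] [IsAlgClosed K]
    [Field L] (k : K →+* L) : IsAlgClosed k.fieldRange := by
  refine IsAlgClosed.of_exists_root _ fun p hp hirr => ?_
  let e := RingEquiv.ofBijective _ k.rangeRestrictField_bijective
  have hd : (p.map e.symm.toRingHom).degree ≠ 0 := by
    rw [Polynomial.degree_map]
    exact hirr.degree_pos.ne'
  obtain ⟨r, hr⟩ := IsAlgClosed.exists_root _ hd
  refine ⟨e r, ?_⟩
  have h1 : (p.map e.symm.toRingHom).map e.toRingHom = p := by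
    rw [Polynomial.map_map]
    have : e.toRingHom.comp e.symm.toRingHom = RingHom.id _ := by ext; simp
    rw [this, Polynomial.map_id]
  have h2 := congrArg e.toRingHom hr
  rw [← Polynomial.eval_map_apply, h1, map_zero] at h2
  exact h2

/-- The free amalgam of two extensions of an algebraically closed field. -/
theorem exists_free_amalgam {E F₁ F₂ : Type u} [Field E] [Field F₁] [Field F₂] [IsAlgClosed E]
    [IsAlgClosed F₂] (f₁ : E →+* F₁) (f₂ : E →+* F₂) :
    ∃ (L : Type u) (_ : Field L) (_ : IsAlgClosed L) (g₁ : F₁ →+* L) (g₂ : F₂ →+* L),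
      g₁.comp f₁ = g₂.comp f₂ ∧
      AlgDisjoint g₁.fieldRange g₂.fieldRange (g₂.comp f₂).fieldRange := by
  let := f₁.toAlgebra
  let := f₂.toAlgebra
  obtain ⟨I, U, φ, hφ⟩ := Ultrapower.exists_hom E F₁
  -- `F₂` sits diagonally in its own ultrapower and `F₁` is sent into the ultrapower of `E`;
  -- families there that are independent over `E` remain independent over `F₂`.
  refine ⟨Filter.Germ (U : Filter I) F₂, inferInstance, inferInstance,
    (Ultrapower.mapHom U f₂).comp φ, Ultrapower.diag U F₂, ?_, ?_⟩
  · ext e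
    have := hφ e
    rw [RingHom.comp_apply, RingHom.comp_apply, RingHom.comp_apply]
    exact (congrArg (Ultrapower.mapHom U f₂) this).trans (Ultrapower.mapHom_diag U f₂ e)
  · intro S hS hi
    choose a ha using fun s : S => hS s.2
    rw [algebraicIndependent_fieldRange_iff] at hi ⊢
    have h1 : ((↑) : S → Filter.Germ (U : Filter I) F₂) =
      fun s => Ultrapower.mapHom U (algebraMap E F₂) (φ (a s)) := funext fun s => (ha s).symm
    rw [h1] at hi ⊢
    refine Ultrapower.injective_eval₂_mapHom U _ ?_
    refine Function.Injective.of_comp (f := Ultrapower.mapHom U (algebraMap E F₂)) ?_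
    have h2 : (Ultrapower.mapHom U (algebraMap E F₂)).comp
        (MvPolynomial.eval₂Hom (Ultrapower.diag U E) fun s => φ (a s)) =
        MvPolynomial.eval₂Hom ((Ultrapower.diag U F₂).comp f₂)
          fun s => Ultrapower.mapHom U (algebraMap E F₂) (φ (a s)) := by
      apply MvPolynomial.ringHom_ext
      · intro c
        simp only [RingHom.comp_apply, MvPolynomial.coe_eval₂Hom, MvPolynomial.eval₂_C]
        rfl
      · intro s
        simp
    rw [← h2] at hi
    exact hi

open TensorProduct in
/-- If `M₁` and `M₂` are algebraically disjoint over `M` in `L`, then the multiplication map from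
their tensor product is injective. -/
theorem AlgDisjoint.injective_lift {M M₁ M₂ L : Type u} [Field M] [Field M₁] [Field M₂] [Field L]
    [IsAlgClosed M] [IsAlgClosed M₂] [Algebra M M₁] [Algebra M M₂] [Algebra M L]
    (f₁ : M₁ →ₐ[M] L) (f₂ : M₂ →ₐ[M] L)
    (h : AlgDisjoint f₁.toRingHom.fieldRange f₂.toRingHom.fieldRange (algebraMap M L).fieldRange) :
    Function.Injective (Algebra.TensorProduct.lift f₁ f₂ fun _ _ => Commute.all _ _) := by
  have hM1 : (algebraMap M L).fieldRange ≤ f₁.toRingHom.fieldRange := by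
    rintro _ ⟨m, rfl⟩
    exact ⟨algebraMap M M₁ m, f₁.commutes m⟩
  have hM2 : (algebraMap M L).fieldRange ≤ f₂.toRingHom.fieldRange := by
    rintro _ ⟨m, rfl⟩
    exact ⟨algebraMap M M₂ m, f₂.commutes m⟩
  let e := Module.Basis.ofVectorSpace M M₂
  let b := Algebra.TensorProduct.basis M₁ e
  refine (injective_iff_map_eq_zero _).2 fun t ht => ?_
  have hli : LinearIndependent (algebraMap M L).fieldRange fun i => f₂ (e i) := by
    rw [linearIndependent_iff']
    intro s g hg i hi
    choose c hc using fun i => (g i).2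
    have h1 := linearIndependent_iff'.1 e.linearIndependent s c ?_ i hi
    · apply Subtype.ext
      rw [← hc, h1, map_zero]
      rfl
    · have h0 : f₂ (∑ i ∈ s, c i • e i) = 0 := by
        rw [map_sum, ← hg]
        refine Finset.sum_congr rfl fun i _ => ?_
        rw [map_smul, Algebra.smul_def, hc]
        rfl
      exact (map_eq_zero f₂.toRingHom).1 h0
  have h2 := h.eq_zero_of_sum_mul_eq_zero hM1 hM2 (RingHom.isAlgClosed_fieldRange _)
    (RingHom.isAlgClosed_fieldRange _) hli (fun i => ⟨e i, rfl⟩) (b.repr t).support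
    (fun i => f₁ (b.repr t i)) (fun i => ⟨_, rfl⟩) ?_
  · have : b.repr t = 0 := by
      ext i
      by_cases hi : i ∈ (b.repr t).support
      · simpa using h2 i hi
      · simpa using hi
    simpa using this
  · rw [← b.linearCombination_repr t, Finsupp.linearCombination_apply, Finsupp.sum, map_sum] at ht
    rw [← ht]
    refine Finset.sum_congr rfl fun i _ => ?_
    simp [b, Algebra.TensorProduct.basis_apply, TensorProduct.smul_tmul', mul_comm]

/-- Let `M₁` and `M₂` be algebraically disjoint over `M` both in `L` and in the algebraically
closed field `K`. Then the relative algebraic closure of the compositum in `L` embeds in `K`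
over `M₁` and `M₂`. -/
theorem AlgDisjoint.exists_lift {M M₁ M₂ L K : Type u} [Field M] [Field M₁] [Field M₂] [Field L]
    [Field K] [IsAlgClosed M] [IsAlgClosed M₂] [IsAlgClosed K] (m₁ : M →+* M₁) (m₂ : M →+* M₂)
    (f₁ : M₁ →+* L) (f₂ : M₂ →+* L) (hf : f₁.comp m₁ = f₂.comp m₂)
    (h : AlgDisjoint f₁.fieldRange f₂.fieldRange (f₁.comp m₁).fieldRange)
    (g₁ : M₁ →+* K) (g₂ : M₂ →+* K) (hg : g₁.comp m₁ = g₂.comp m₂)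
    (h' : AlgDisjoint g₁.fieldRange g₂.fieldRange (g₁.comp m₁).fieldRange) :
    ∃ (P : Subfield L) (Ψ : P →+* K),
      (∀ x, x ∈ P ↔ IsAlgebraic (f₁.fieldRange ⊔ f₂.fieldRange : Subfield L) x) ∧
      (∀ x, ∃ hx : f₁ x ∈ P, Ψ ⟨f₁ x, hx⟩ = g₁ x) ∧
      (∀ x, ∃ hx : f₂ x ∈ P, Ψ ⟨f₂ x, hx⟩ = g₂ x) := by
  let := m₁.toAlgebra
  let := m₂.toAlgebra
  let := (f₁.comp m₁).toAlgebra
  let := (g₁.comp m₁).toAlgebra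
  let f₁' : M₁ →ₐ[M] L := { f₁ with commutes' := fun _ => rfl }
  let f₂' : M₂ →ₐ[M] L := { f₂ with commutes' := fun m => (congr($hf m)).symm }
  let g₁' : M₁ →ₐ[M] K := { g₁ with commutes' := fun _ => rfl }
  let g₂' : M₂ →ₐ[M] K := { g₂ with commutes' := fun m => (congr($hg m)).symm }
  -- In `L` and in `K`, the ring generated by `M₁` and `M₂` is a copy of their tensor product. The
  -- resulting isomorphism of these rings extends to algebraic elements because `K` is algebraically
  -- closed.
  have hF := AlgDisjoint.injective_lift f₁' f₂' h
  have hG := AlgDisjoint.injective_lift g₁' g₂' h'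
  let φ := (Algebra.TensorProduct.lift f₁' f₂' fun _ _ => Commute.all _ _).toRingHom
  let γ := (Algebra.TensorProduct.lift g₁' g₂' fun _ _ => Commute.all _ _).toRingHom
  have : IsDomain (TensorProduct M M₁ M₂) := hF.isDomain φ
  let := φ.toAlgebra
  have : FaithfulSMul (TensorProduct M M₁ M₂) L :=
    (faithfulSMul_iff_algebraMap_injective _ L).2 hF
  obtain ⟨Ψ, hΨ⟩ := exists_algSubfield_lift (F := L) γ hG
  have h1 : ∀ x, ∃ hx : f₁ x ∈ algSubfield (TensorProduct M M₁ M₂) L, Ψ ⟨f₁ x, hx⟩ = g₁ x := by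
    intro x
    have e1 : algebraMap (TensorProduct M M₁ M₂) L (x ⊗ₜ 1) = f₁ x := by
      change φ _ = _
      simp [φ, f₁']
    have e2 : γ (x ⊗ₜ 1) = g₁ x := by simp [γ, g₁']
    have hx : algebraMap (TensorProduct M M₁ M₂) L (x ⊗ₜ 1) ∈
      algSubfield (TensorProduct M M₁ M₂) L := isAlgebraic_algebraMap _
    have hx' : Ψ ⟨_, hx⟩ = _ := hΨ (x ⊗ₜ 1)
    simp_rw [e1] at hx hx'
    exact ⟨hx, hx'.trans e2⟩
  have h2 : ∀ x, ∃ hx : f₂ x ∈ algSubfield (TensorProduct M M₁ M₂) L, Ψ ⟨f₂ x, hx⟩ = g₂ x := by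
    intro x
    have e1 : algebraMap (TensorProduct M M₁ M₂) L (1 ⊗ₜ x) = f₂ x := by
      change φ _ = _
      simp [φ, f₂']
    have e2 : γ (1 ⊗ₜ x) = g₂ x := by simp [γ, g₂']
    have hx : algebraMap (TensorProduct M M₁ M₂) L (1 ⊗ₜ x) ∈
      algSubfield (TensorProduct M M₁ M₂) L := isAlgebraic_algebraMap _
    have hx' : Ψ ⟨_, hx⟩ = _ := hΨ (1 ⊗ₜ x)
    simp_rw [e1] at hx hx'
    exact ⟨hx, hx'.trans e2⟩
  refine ⟨_, Ψ, fun x => ⟨fun hx => ?_, fun hx => ?_⟩, h1, h2⟩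
  · have hr : ∀ t, φ t ∈ f₁.fieldRange ⊔ f₂.fieldRange := by
      intro t
      induction t using TensorProduct.induction_on with
      | zero => rw [map_zero]; exact zero_mem _
      | add a b ha hb => rw [map_add]; exact add_mem ha hb
      | tmul a b =>
        have : φ (a ⊗ₜ b) = f₁ a * f₂ b := by simp [φ, f₁', f₂']
        rw [this]
        exact mul_mem ((le_sup_left : f₁.fieldRange ≤ _) ⟨a, rfl⟩)
          ((le_sup_right : f₂.fieldRange ≤ _) ⟨b, rfl⟩)
    have hx' : IsAlgebraic (TensorProduct M M₁ M₂) x := hx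
    exact hx'.ringHom_of_comp_eq
      (φ.codRestrict (f₁.fieldRange ⊔ f₂.fieldRange) hr) (RingHom.id L)
      (fun a b hab => hF (congrArg Subtype.val hab)) rfl
  · refine mem_algSubfield_of_isAlgebraic (hx.of_subfield_le (sup_le ?_ ?_))
    · rintro _ ⟨y, rfl⟩
      exact (h1 y).1
    · rintro _ ⟨y, rfl⟩
      exact (h2 y).1

/-! ### Transport of algebraic disjointness along embeddings -/

theorem algebraicIndependent_map_iff {F : Type u} {K : Type v} [Field F] [Field K] (f : F →+* K)
    (C : Subfield F) {ι : Type*} (x : ι → F) :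
    AlgebraicIndependent (C.map f) (f ∘ x) ↔ AlgebraicIndependent C x := by
  let k : C →+* C.map f := f.restrict C (C.map f) fun y hy => ⟨y, hy, rfl⟩
  exact ⟨fun h => AlgebraicIndependent.of_ringHom_of_comp_eq k f h k.injective rfl,
    fun h => AlgebraicIndependent.ringHom_of_comp_eq k f h
      (by rintro ⟨_, y, hy, rfl⟩; exact ⟨⟨y, hy⟩, rfl⟩) f.injective rfl⟩

theorem algDisjoint_map_iff {F : Type u} {K : Type v} [Field F] [Field K] (f : F →+* K)
    {A B C : Subfield F} : AlgDisjoint (A.map f) (B.map f) (C.map f) ↔ AlgDisjoint A B C := by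
  constructor
  · intro h S hS hi
    refine (algebraicIndependent_map_iff f B _).1 (h.algebraicIndependent (fun s => ?_)
      ((algebraicIndependent_map_iff f C _).2 hi))
    exact ⟨s, hS s.2, rfl⟩
  · intro h S hS hi
    choose a ha hfa using fun s : S => hS s.2
    have e : ((↑) : S → K) = f ∘ a := funext fun s => (hfa s).symm
    rw [e] at hi ⊢
    exact (algebraicIndependent_map_iff f B a).2
      (h.algebraicIndependent ha ((algebraicIndependent_map_iff f C a).1 hi))

theorem isAlgClosed_of_forall_mem {F : Type u} [Field F] [IsAlgClosed F] {P : Subfield F}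
    (h : ∀ x, IsAlgebraic P x → x ∈ P) : IsAlgClosed P := by
  refine IsAlgClosed.of_exists_root _ fun p hp hirr => ?_
  obtain ⟨r, hr⟩ := IsAlgClosed.exists_aeval_eq_zero F p hirr.degree_pos.ne'
  have hrP : r ∈ P := h r ⟨p, hp.ne_zero, hr⟩
  refine ⟨⟨r, hrP⟩, P.subtype.injective ?_⟩
  rw [map_zero]
  exact (Polynomial.aeval_algebraMap_apply_eq_algebraMap_eval (A := F) (⟨r, hrP⟩ : P) p).symm.trans
    hr

namespace ExpFields

/-! ### Transcendence degrees of finite sets -/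

theorem td_subfield {F : Type u} [Field F] (D : Set F) (K : Subfield F) :
    td D K = Algebra.trdeg K (IntermediateField.adjoin K D) := by
  have : ∀ K' : Subfield F, K' = K → Algebra.trdeg K' (IntermediateField.adjoin K' D) =
      Algebra.trdeg K (IntermediateField.adjoin K D) := by
    rintro _ rfl
    rfl
  exact this _ (Subfield.closure_eq K)

theorem exists_subset_td_eq {F : Type u} [Field F] (D : Set F) (K : Subfield F) :
    ∃ S ⊆ D, AlgebraicIndependent K ((↑) : S → F) ∧ td D K = #S := by
  let E := IntermediateField.adjoin K D
  let s : Set E := (↑) ⁻¹' D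
  have : Algebra.IsAlgebraic (Algebra.adjoin K s) E := by
    refine ⟨fun ⟨x, hx⟩ => ?_⟩
    let W := algSubfield (Algebra.adjoin K s) E
    change (⟨x, hx⟩ : E) ∈ W
    induction hx using IntermediateField.adjoin_induction with
    | mem y hy =>
      exact isAlgebraic_algebraMap (⟨⟨y, _⟩, Algebra.subset_adjoin hy⟩ : Algebra.adjoin K s)
    | algebraMap k => exact isAlgebraic_algebraMap (algebraMap K (Algebra.adjoin K s) k)
    | add _ _ _ _ h1 h2 => exact add_mem h1 h2
    | mul _ _ _ _ h1 h2 => exact mul_mem h1 h2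
    | inv _ _ h => exact inv_mem h
  have : FaithfulSMul K E :=
    (faithfulSMul_iff_algebraMap_injective K E).2 (algebraMap K E).injective
  obtain ⟨t, hts, ht⟩ := exists_isTranscendenceBasis_subset (R := K) s
  refine ⟨(↑) '' t, ?_, ?_, ?_⟩
  · rintro _ ⟨y, hy, rfl⟩
    exact hts hy
  · exact (AlgebraicIndependent.image (s := t) (f := E.val)
      (ht.1.map' (f := E.val) E.val.injective))
  · rw [td_subfield, ← ht.cardinalMk_eq_trdeg]
    exact (mk_image_eq Subtype.val_injective).symm

theorem mk_le_td {F : Type u} [Field F] {D S : Set F} {K : Subfield F} (hS : S ⊆ D)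
    (h : AlgebraicIndependent K ((↑) : S → F)) : #S ≤ td D K := by
  rw [td_subfield]
  let x : S → IntermediateField.adjoin K D := fun s =>
    ⟨s, IntermediateField.subset_adjoin K D (hS s.2)⟩
  have hx : AlgebraicIndependent K x :=
    AlgebraicIndependent.of_comp (IntermediateField.adjoin K D).val h
  exact hx.cardinalMk_le_trdeg

/-- Over either base, a finite set contains a transcendence basis of the field it generates. Equal
transcendence degrees force a finite set independent over `C` to be its own basis over `B`;
conversely, a basis over `C` remains independent over `B`. -/
theorem tdIndep_iff {F : Type u} [Field F] {A B C : Subfield F} (hCB : C ≤ B) :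
    TdIndep (A : Set F) B C ↔ AlgDisjoint A B C := by
  have hBC : (B : Set F) ∪ C = B := Set.union_eq_left.2 hCB
  constructor
  · intro h S hSA hSi
    refine algebraicIndependent_of_finite S fun D hDS hD => ?_
    have h1 := h D (hDS.trans hSA) hD
    rw [hBC] at h1
    obtain ⟨S', hS'D, hS'i, hS'⟩ := exists_subset_td_eq D B
    have h2 : #D ≤ #S' := by
      rw [← hS', h1]
      exact mk_le_td subset_rfl (hSi.mono hDS)
    have h3 : S' = D := by
      refine Set.eq_of_subset_of_ncard_le hS'D ?_ hD
      rw [Set.ncard_def, Set.ncard_def, Set.encard, Set.encard, ENat.card, ENat.card]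
      refine ENat.toNat_le_toNat (toENat.monotone' h2) ?_
      have := (hD.subset hS'D).to_subtype
      simpa using hD.subset hS'D
    rwa [← h3]
  · intro h D hDA hD
    rw [hBC]
    obtain ⟨S, hSD, hSi, hS⟩ := exists_subset_td_eq D C
    obtain ⟨S', hSD', hSi', hS'⟩ := exists_subset_td_eq D B
    apply le_antisymm
    · rw [hS']
      exact mk_le_td hSD' (hSi'.of_subfield_le hCB)
    · rw [hS]
      exact mk_le_td hSD (h S (hSD.trans hDA) hSi)

theorem exists_isAlgebraic_of_directed {F : Type u} [Field F] {ι : Type*} [Nonempty ι]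
    {S : ι → Subfield F} (hd : Directed (· ≤ ·) S) {x : F}
    (hx : IsAlgebraic (⨆ i, S i : Subfield F) x) : ∃ i, IsAlgebraic (S i) x := by
  obtain ⟨p, hp, hpx⟩ := hx
  have hk : ∀ k, ∃ i, (p.coeff k : F) ∈ S i := fun k =>
    (Subfield.mem_iSup_of_directed hd).1 (p.coeff k).2
  classical
  choose i hi using hk
  obtain ⟨j, hj⟩ := hd.finset_le (p.support.image i)
  have hpj : ∀ k, (p.coeff k : F) ∈ S j := by
    intro k
    by_cases hk : k ∈ p.support
    · exact hj _ (Finset.mem_image_of_mem i hk) (hi k)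
    · rw [Polynomial.notMem_support_iff.1 hk]
      exact zero_mem _
  have hl : p.map (algebraMap _ F) ∈ Polynomial.lifts (algebraMap (S j) F) := by
    rw [Polynomial.lifts_iff_coeff_lifts]
    intro k
    rw [Polynomial.coeff_map]
    exact ⟨⟨_, hpj k⟩, rfl⟩
  obtain ⟨q, hq⟩ := (Polynomial.mem_lifts _).1 hl
  refine ⟨j, q, ?_, ?_⟩
  · rintro rfl
    rw [Polynomial.map_zero, eq_comm] at hq
    exact hp ((Polynomial.map_eq_zero _).1 hq)
  · rw [Polynomial.aeval_def, ← Polynomial.eval_map, hq, Polynomial.eval_map]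
    exact hpx

/-! ### EA-closures -/

section Closure

variable {F : Type u} [ExponentialField F]

theorem eaClosure_mono {A B : Set F} (h : A ⊆ B) : eaClosure A ≤ eaClosure B :=
  sInf_le_sInf fun _ hS => ⟨hS.1, h.trans hS.2⟩

theorem IsEASubfield.eaClosure_eq {S : Subfield F} (hS : IsEASubfield S) :
    eaClosure (S : Set F) = S :=
  le_antisymm (eaClosure_le hS subset_rfl) (subset_eaClosure _)

variable [IsAlgClosed F]

theorem IsEASubfield.of_isAlgebraic {S : Subfield F} (hS : ∀ a ∈ S, expo a ∈ S)
    (h : ∀ x, IsAlgebraic S x → x ∈ S) : IsEASubfield S :=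
  ⟨hS, isAlgClosed_of_forall_mem h⟩

/-- The union of a directed family of EA-subfields is an EA-subfield. -/
theorem isEASubfield_iSup {ι : Type*} [Nonempty ι] {S : ι → Subfield F}
    (hS : ∀ i, IsEASubfield (S i)) (hd : Directed (· ≤ ·) S) : IsEASubfield (⨆ i, S i) := by
  refine IsEASubfield.of_isAlgebraic (fun a ha => ?_) fun x hx => ?_
  · obtain ⟨i, hi⟩ := (Subfield.mem_iSup_of_directed hd).1 ha
    exact (Subfield.mem_iSup_of_directed hd).2 ⟨i, (hS i).expo_mem a hi⟩
  · obtain ⟨i, hi⟩ := exists_isAlgebraic_of_directed hd hx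
    exact le_iSup S i (Subfield.mem_of_isAlgebraic (hS i).algClosed hi)

theorem mem_eaClosure_iUnion {ι : Type*} [Nonempty ι] {A : ι → Set F}
    (hd : Directed (· ⊆ ·) A) {x : F} :
    x ∈ eaClosure (⋃ i, A i) ↔ ∃ i, x ∈ eaClosure (A i) := by
  have hd' : Directed (· ≤ ·) fun i => eaClosure (A i) := fun i j => by
    obtain ⟨k, hik, hjk⟩ := hd i j
    exact ⟨k, eaClosure_mono hik, eaClosure_mono hjk⟩
  rw [← Subfield.mem_iSup_of_directed hd']
  constructor
  · intro h
    refine eaClosure_le (isEASubfield_iSup (fun i => isEASubfield_eaClosure _) hd') ?_ h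
    exact Set.iUnion_subset fun i =>
      (subset_eaClosure _).trans (le_iSup (fun i => eaClosure (A i)) i)
  · exact fun h => iSup_le (fun i => eaClosure_mono (Set.subset_iUnion A i)) h

theorem exists_finite_mem_eaClosure {A : Set F} {x : F} (hx : x ∈ eaClosure A) :
    ∃ D : Set F, D ⊆ A ∧ D.Finite ∧ x ∈ eaClosure D := by
  classical
  have h : A = ⋃ D : Finset A, ((↑) '' (D : Set A) : Set F) := by
    ext a
    simp only [Set.mem_iUnion]
    exact ⟨fun ha => ⟨{⟨a, ha⟩}, ⟨⟨a, ha⟩, by simp, rfl⟩⟩,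
      by rintro ⟨D, ⟨b, hb⟩, -, rfl⟩; exact hb⟩
  rw [h, mem_eaClosure_iUnion] at hx
  · obtain ⟨D, hD⟩ := hx
    exact ⟨_, by rintro _ ⟨b, -, rfl⟩; exact b.2, D.finite_toSet.image _, hD⟩
  · intro D D'
    exact ⟨D ∪ D', Set.image_mono (by simp), Set.image_mono (by simp)⟩

theorem exists_finite_subset_eaClosure {A D : Set F} (hD : D.Finite) (h : D ⊆ eaClosure A) :
    ∃ D' : Set F, D' ⊆ A ∧ D'.Finite ∧ D ⊆ eaClosure D' := by
  choose f hf hfin hmem using fun x : D => exists_finite_mem_eaClosure (h x.2)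
  have := hD.to_subtype
  exact ⟨⋃ x, f x, Set.iUnion_subset hf, Set.finite_iUnion hfin, fun x hx =>
    eaClosure_mono (Set.subset_iUnion f ⟨x, hx⟩) (hmem ⟨x, hx⟩)⟩

omit [IsAlgClosed F] in
theorem IsEASubfield.eaClosure_union_left {S : Subfield F} (hS : IsEASubfield S) {A : Set F}
    (hA : A ⊆ S) : eaClosure ((S : Set F) ∪ A) = S := by
  rw [Set.union_eq_left.2 hA, hS.eaClosure_eq]

end Closure

/-! ### EA-independence -/

theorem eaIndep_iff {F : EAField.{u}} {A B C : Set F.carrier} :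
    EAIndep F A B C ↔
      AlgDisjoint (eaClosure (A ∪ C)) (eaClosure (B ∪ C)) (eaClosure C) :=
  tdIndep_iff (eaClosure_mono Set.subset_union_right)

theorem eaIndep_iff_of_isEASubfield {F : EAField.{u}} {A B C : Subfield F.carrier}
    (hA : IsEASubfield A) (hB : IsEASubfield B) (hC : IsEASubfield C) (hCA : C ≤ A)
    (hCB : C ≤ B) : EAIndep F A B C ↔ AlgDisjoint A B C := by
  rw [eaIndep_iff, hA.eaClosure_union_left hCA, hB.eaClosure_union_left hCB, hC.eaClosure_eq]

theorem isIndependenceRelation_eaIndep (F : EAField.{u}) :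
    IndepRel.IsIndependenceRelation (EAIndep F) where
  normality A B C h := by
    rw [eaIndep_iff] at h ⊢
    rwa [Set.union_assoc, Set.union_self]
  existence A C := by
    rw [eaIndep_iff, Set.union_self]
    exact fun _ _ h => h
  monotonicity A B C D h hD := by
    rw [eaIndep_iff] at h ⊢
    exact h.mono_right (eaClosure_mono (Set.union_subset_union_left C hD))
  transitivity A B C D h1 h2 hCD := by
    rw [eaIndep_iff] at h1 h2 ⊢
    rw [Set.union_eq_left.2 hCD] at h1
    intro S hS hi
    refine (h2 S (hS.trans (eaClosure_mono (Set.union_subset_union_right A hCD)))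
      (h1 S hS hi)).of_subfield_le (eaClosure_mono (Set.union_subset_union_right B hCD))
  symmetry A B C h := by
    rw [eaIndep_iff] at h ⊢
    exact h.symm (eaClosure_mono Set.subset_union_right)
  finite_character A B C h := by
    rw [eaIndep_iff]
    intro S hS hi
    refine algebraicIndependent_of_finite S fun D hDS hD => ?_
    obtain ⟨D', hD'A, hD'fin, hDD'⟩ := exists_finite_subset_eaClosure hD (hDS.trans hS)
    -- `D'` is a finite subset of `A ∪ C`; its part in `C` may be dropped, as `C` is adjoined
    -- anyway.
    have h1 := eaIndep_iff.1 (h (D' ∩ A) Set.inter_subset_right (hD'fin.inter_of_left _))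
    refine h1 D (hDD'.trans (eaClosure_mono fun x hx => ?_)) (hi.mono hDS)
    exact (hD'A hx).imp (fun h => ⟨hx, h⟩) id

/-! ### Invariance -/

section Arrows

variable {M N : EAField.{u}} (f : M ⟶ N)

/-- The field embedding that underlies an arrow. -/
def toRingHom : M.carrier →+* N.carrier := (f : ExpEmbedding M.carrier N.carrier).toRingHom

theorem toRingHom_expo (a : M.carrier) : toRingHom f (expo a) = expo (toRingHom f a) :=
  (f : ExpEmbedding M.carrier N.carrier).map_expo a

theorem isEASubfield_map {S : Subfield M.carrier} (hS : IsEASubfield S) :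
    IsEASubfield (S.map (toRingHom f)) := by
  refine ⟨?_, ?_⟩
  · rintro _ ⟨a, ha, rfl⟩
    exact ⟨expo a, hS.expo_mem a ha, toRingHom_expo f a⟩
  · have := hS.algClosed
    have h := RingHom.isAlgClosed_fieldRange ((toRingHom f).comp S.subtype)
    have e : ((toRingHom f).comp S.subtype).fieldRange = S.map (toRingHom f) := by
      ext x
      simp [RingHom.mem_fieldRange, Subfield.mem_map]
    rwa [e] at h

theorem isEASubfield_comap {S : Subfield N.carrier} (hS : IsEASubfield S) :
    IsEASubfield (S.comap (toRingHom f)) := by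
  refine IsEASubfield.of_isAlgebraic (fun a ha => ?_) fun x hx => ?_
  · rw [Subfield.mem_comap, toRingHom_expo]
    exact hS.expo_mem _ ha
  · refine Subfield.mem_of_isAlgebraic hS.algClosed ?_
    exact hx.ringHom_of_comp_eq ((toRingHom f).restrict (S.comap (toRingHom f)) S fun _ h => h)
      (toRingHom f) (RingHom.injective _) rfl

/-- Images and preimages of EA-subfields under arrows are EA-subfields, so each closure contains the
other. -/
theorem eaClosure_image (A : Set M.carrier) :
    eaClosure (f '' A) = (eaClosure A).map (toRingHom f) := by
  apply le_antisymm
  · refine eaClosure_le (isEASubfield_map f (isEASubfield_eaClosure A)) ?_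
    rintro _ ⟨a, ha, rfl⟩
    exact ⟨a, subset_eaClosure A ha, rfl⟩
  · rw [Subfield.map_le_iff_le_comap]
    refine eaClosure_le (isEASubfield_comap f (isEASubfield_eaClosure _)) fun a ha => ?_
    exact subset_eaClosure _ ⟨a, ha, rfl⟩

theorem isEASubfield_fieldRange : IsEASubfield (toRingHom f).fieldRange := by
  rw [RingHom.fieldRange_eq_map]
  exact isEASubfield_map f ⟨fun _ _ => trivial,
    IsAlgClosed.of_ringEquiv M.carrier _ Subfield.topEquiv.symm⟩

end Arrows

theorem isIndependenceRelationOn_eaIndep :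
    IndepRel.IsIndependenceRelationOn (C := EAField.{u}) EAIndep where
  basic := isIndependenceRelation_eaIndep
  invariance := by
    intro M N f A B P
    rw [eaIndep_iff, eaIndep_iff]
    have h1 := eaClosure_image f (A ∪ P)
    have h2 := eaClosure_image f (B ∪ P)
    rw [Set.image_union] at h1 h2
    rw [← algDisjoint_map_iff (toRingHom f), ← eaClosure_image f P, ← h1, ← h2]

end ExpFields

namespace ExpFields

/-! ### Extending exponential maps -/

section Expo

variable {F : Type u} [ExponentialField F]

theorem expo_add (a b : F) : expo (a + b) = expo a * expo b := by
  simp [expo, ofAdd_add]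

theorem expo_zero : expo (0 : F) = 1 := by
  simp [expo]

theorem expo_mul_expo_neg (a : F) : expo a * expo (-a) = 1 := by
  rw [← expo_add, add_neg_cancel, expo_zero]

/-- The exponential map as an additive homomorphism to the units. -/
def expAdd (F : Type u) [ExponentialField F] : F →+ Additive Fˣ :=
  AddMonoidHom.toMultiplicativeLeft.symm (ExponentialField.expHom (F := F))

end Expo

/-- Existence of roots makes the unit group divisible, hence injective as an abelian group; all
extensions of exponential maps depend on this. -/
theorem exists_zsmul_eq {L : Type u} [Field L] [IsAlgClosed L] {n : ℤ} (hn : n ≠ 0)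
    (a : Additive Lˣ) : ∃ b, n • b = a := by
  obtain ⟨z, hz⟩ := IsAlgClosed.exists_pow_nat_eq (a.toMul : L) (Int.natAbs_pos.2 hn)
  have hz0 : z ≠ 0 := by
    rintro rfl
    rw [zero_pow (Int.natAbs_pos.2 hn).ne'] at hz
    exact a.toMul.ne_zero hz.symm
  have h1 : n.natAbs • Additive.ofMul (Units.mk0 z hz0) = a := by
    apply Additive.toMul.injective
    ext
    simpa using hz
  rcases Int.natAbs_eq n with h | h
  · exact ⟨_, by rw [h, natCast_zsmul]; exact h1⟩
  · exact ⟨-Additive.ofMul (Units.mk0 z hz0), by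
      rw [h, neg_smul_neg, natCast_zsmul]; exact h1⟩

/-- A homomorphism to the units of an algebraically closed field that is defined on a subgroup of
the additive group extends. -/
theorem exists_addMonoidHom_extension {L : Type u} [Field L] [IsAlgClosed L] {G : Type v} {Y : Type w}
    [AddCommGroup G] [AddCommGroup Y] (s : G →+ Y) (t : G →+ Additive Lˣ)
    (h : ∀ g, s g = 0 → t g = 0) : ∃ e : Y →+ Additive Lˣ, ∀ g, e (s g) = t g := by
  let := divisibleByOfSMulRightSurj (Additive Lˣ) ℤ fun hn a => exists_zsmul_eq hn a
  have hst : ∀ g g', s g = s g' → t g = t g' := fun g g' hg => by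
    rw [← sub_eq_zero, ← map_sub]
    exact h _ (by rw [map_sub, hg, sub_self])
  choose c hc using fun y : s.range => y.2
  let r : s.range →+ Additive Lˣ :=
    AddMonoidHom.mk' (fun y => t (c y)) fun x y => by
      rw [← map_add]
      apply hst
      rw [map_add, hc, hc, hc]
      rfl
  obtain ⟨e, he⟩ := (Module.Baer.of_divisible (Additive Lˣ)).extension_property_addMonoidHom
    s.range.subtype Subtype.val_injective r
  refine ⟨e, fun g => ?_⟩
  refine (congr($he ⟨s g, g, rfl⟩)).trans ?_
  exact hst _ _ (hc ⟨s g, g, rfl⟩)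

/-- The EA-field with a given exponential map. -/
def EAField.ofAddHom (L : Type u) [Field L] [CharZero L] [IsAlgClosed L] (e : L →+ Additive Lˣ) :
    EAField.{u} where
  carrier := L
  expField := { (inferInstance : Field L), (inferInstance : CharZero L) with
    expHom := AddMonoidHom.toMultiplicativeLeft e }
  algClosed := inferInstanceAs (IsAlgClosed L)

/-- An arrow to `EAField.ofAddHom L e`. -/
def EAField.arrow {M : EAField.{u}} {L : Type u} [Field L] [CharZero L] [IsAlgClosed L]
    {e : L →+ Additive Lˣ} (g : M.carrier →+* L)
    (h : ∀ a, ((e (g a)).toMul : L) = g (expo a)) : M ⟶ EAField.ofAddHom L e :=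
  (⟨g, fun a => (h a).symm⟩ : ExpEmbedding M.carrier (EAField.ofAddHom L e).carrier)

/-- The given exponentials define a homomorphism on the product of the three additive groups. The
hypothesis says that it descends to the sum of their images in `L`, from where it extends by
divisibility. -/
theorem exists_exp_extension {L : Type u} [Field L] [IsAlgClosed L]
    {M₁ M₂ M₃ : EAField.{u}} (g₁ : M₁.carrier →+* L) (g₂ : M₂.carrier →+* L)
    (g₃ : M₃.carrier →+* L)
    (h : ∀ x y z, g₁ x + g₂ y + g₃ z = 0 → g₁ (expo x) * g₂ (expo y) * g₃ (expo z) = 1) :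
    ∃ e : L →+ Additive Lˣ, (∀ x, ((e (g₁ x)).toMul : L) = g₁ (expo x)) ∧
      (∀ x, ((e (g₂ x)).toMul : L) = g₂ (expo x)) ∧
      (∀ x, ((e (g₃ x)).toMul : L) = g₃ (expo x)) := by
  let t : ∀ {M : EAField.{u}}, (M.carrier →+* L) → M.carrier →+ Additive Lˣ := fun {M} g =>
    (MonoidHom.toAdditive (Units.map (g : M.carrier →* L))).comp (expAdd M.carrier)
  have ht : ∀ {M : EAField.{u}} (g : M.carrier →+* L) x, ((t g x).toMul : L) = g (expo x) :=
    fun _ _ => rfl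
  obtain ⟨e, he⟩ := exists_addMonoidHom_extension
    (g₁.toAddMonoidHom.coprod (g₂.toAddMonoidHom.coprod g₃.toAddMonoidHom))
    ((t g₁).coprod ((t g₂).coprod (t g₃))) (by
      rintro ⟨x, y, z⟩ hxyz
      apply Additive.toMul.injective
      ext
      refine Eq.trans ?_ (h x y z (by simpa [add_assoc] using hxyz))
      simp [ht, mul_assoc])
  refine ⟨e, fun x => ?_, fun x => ?_, fun x => ?_⟩
  · rw [← ht]
    have := he (x, 0, 0)
    simp only [AddMonoidHom.coprod_apply, map_zero, add_zero] at this
    exact congrArg (fun a : Additive Lˣ => (a.toMul : L)) this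
  · rw [← ht]
    have := he (0, x, 0)
    simp only [AddMonoidHom.coprod_apply, map_zero, add_zero, zero_add] at this
    exact congrArg (fun a : Additive Lˣ => (a.toMul : L)) this
  · rw [← ht]
    have := he (0, 0, x)
    simp only [AddMonoidHom.coprod_apply, map_zero, zero_add] at this
    exact congrArg (fun a : Additive Lˣ => (a.toMul : L)) this

theorem arrow_ext {M N : EAField.{u}} {f g : M ⟶ N} (h : ∀ a, toRingHom f a = toRingHom g a) :
    f = g :=
  DFunLike.coe_injective (F := ExpEmbedding M.carrier N.carrier) (funext h)

/-- An additive relation between `M₁` and `M₂` is an element of their intersection, which comes from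
`M`, where the exponentials agree. -/
theorem exists_exp_extension₂ {L : Type u} [Field L] [IsAlgClosed L] {M M₁ M₂ : EAField.{u}}
    (f₁ : M ⟶ M₁) (f₂ : M ⟶ M₂) (g₁ : M₁.carrier →+* L) (g₂ : M₂.carrier →+* L)
    (hg : g₁.comp (toRingHom f₁) = g₂.comp (toRingHom f₂))
    (h : g₁.fieldRange ⊓ g₂.fieldRange ≤ (g₂.comp (toRingHom f₂)).fieldRange) :
    ∃ e : L →+ Additive Lˣ, (∀ x, ((e (g₁ x)).toMul : L) = g₁ (expo x)) ∧
      (∀ x, ((e (g₂ x)).toMul : L) = g₂ (expo x)) := by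
  obtain ⟨e, h1, h2, -⟩ := exists_exp_extension g₁ g₂ g₂ fun x y z hxyz => by
    rw [add_assoc, ← map_add] at hxyz
    rw [mul_assoc, ← map_mul, ← expo_add]
    have hx : g₁ x = g₂ (-(y + z)) := by rw [map_neg]; exact eq_neg_of_add_eq_zero_left hxyz
    obtain ⟨a, ha⟩ := h ⟨⟨x, rfl⟩, ⟨_, hx.symm⟩⟩
    have hx' : x = toRingHom f₁ a := g₁.injective (by
      rw [← ha]
      exact (congr($hg a)).symm)
    have hy' : -(y + z) = toRingHom f₂ a := g₂.injective (by rw [← hx, ← ha]; rfl)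
    rw [hx', ← neg_neg (y + z), hy', ← toRingHom_expo, ← map_neg, ← toRingHom_expo]
    have := congr($hg (expo a))
    simp only [RingHom.comp_apply] at this
    rw [this, ← map_mul, ← map_mul, expo_mul_expo_neg, map_one, map_one]
  exact ⟨e, h1, h2⟩

/-! ### Free amalgams of EA-fields -/

theorem exists_free_amalgam_eaField {M M₁ M₂ : EAField.{u}} (f₁ : M ⟶ M₁) (f₂ : M ⟶ M₂) :
    ∃ (N : EAField.{u}) (g₁ : M₁ ⟶ N) (g₂ : M₂ ⟶ N), f₁ ≫ g₁ = f₂ ≫ g₂ ∧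
      AlgDisjoint (toRingHom g₁).fieldRange (toRingHom g₂).fieldRange
        (toRingHom (f₂ ≫ g₂)).fieldRange := by
  obtain ⟨L, _, _, g₁, g₂, hg, hd⟩ := exists_free_amalgam (toRingHom f₁) (toRingHom f₂)
  have : CharZero L := charZero_of_injective_ringHom g₁.injective
  obtain ⟨e, h1, h2⟩ := exists_exp_extension₂ f₁ f₂ g₁ g₂ hg (hd.inf_le
    (by rw [← hg]; rintro _ ⟨a, rfl⟩; exact ⟨_, rfl⟩) (by rintro _ ⟨a, rfl⟩; exact ⟨_, rfl⟩)
    (RingHom.isAlgClosed_fieldRange _) (RingHom.isAlgClosed_fieldRange _))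
  exact ⟨EAField.ofAddHom L e, EAField.arrow g₁ h1, EAField.arrow g₂ h2,
    arrow_ext fun a => congr($hg a), hd⟩

theorem hasAmalgamation_eaField : IndepRel.HasAmalgamation EAField.{u} := fun f₁ f₂ => by
  obtain ⟨N, g₁, g₂, h, -⟩ := exists_free_amalgam_eaField f₁ f₂
  exact ⟨N, g₁, g₂, h⟩

/-- An EA-subfield as an EA-field. -/
def IsEASubfield.toEAField {M : EAField.{u}} {S : Subfield M.carrier} (hS : IsEASubfield S) :
    EAField.{u} :=
  let _ := hS.algClosed
  EAField.ofAddHom S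
    { toFun := fun a => Additive.ofMul (Units.mk0 ⟨expo (a : M.carrier), hS.expo_mem a a.2⟩
        fun h => (Units.ne_zero _ : expo (a : M.carrier) ≠ 0) congr(($h).1))
      map_zero' := by
        apply Additive.toMul.injective
        ext
        exact expo_zero
      map_add' := fun a b => by
        apply Additive.toMul.injective
        ext
        exact expo_add _ _ }

/-- The inclusion of an EA-subfield. -/
def IsEASubfield.incl {M : EAField.{u}} {S : Subfield M.carrier} (hS : IsEASubfield S) :
    hS.toEAField ⟶ M :=
  (⟨S.subtype, fun _ => rfl⟩ : ExpEmbedding hS.toEAField.carrier M.carrier)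

/-- Two copies of `M` are amalgamated freely over `⟨B ∪ P⟩^EA`. The second copy is the extension and
contains `B'`; the first provides the new tuple. Families independent over `⟨P⟩^EA` stay so over `⟨B
∪ P⟩^EA` by hypothesis, and then over the whole second copy by freeness. -/
theorem extension_eaIndep : IndepRel.Extension (C := EAField.{u}) EAIndep := by
  intro M ι a B B' P hind _
  have hE := isEASubfield_eaClosure (F := M.carrier) (B ∪ P)
  obtain ⟨N, g₁, g₂, hg, hd⟩ := exists_free_amalgam_eaField hE.incl hE.incl
  have hgE : ∀ x ∈ eaClosure (B ∪ P), g₁ x = g₂ x := fun x hx => congr($hg ⟨x, hx⟩)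
  refine ⟨N, g₂, fun i => g₁ (a i), ?_, N, 𝟙 N, g₁, ?_⟩
  · rw [eaIndep_iff] at hind ⊢
    have hP : g₂ '' P = g₁ '' P := Set.image_congr fun x hx =>
      (hgE x (subset_eaClosure _ (Or.inr hx))).symm
    have h1 := eaClosure_image g₁ (Set.range a ∪ P)
    rw [Set.image_union, ← Set.range_comp, ← hP] at h1
    have h2 := eaClosure_image g₁ P
    have h3 := eaClosure_image g₂ (B' ∪ P)
    rw [Set.image_union] at h3
    refine AlgDisjoint.mono_right (B := (toRingHom g₂).fieldRange) ?_ ?_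
    · intro S hS hi
      have hS' : S ⊆ (eaClosure (Set.range a ∪ P)).map (toRingHom g₁) := by
        rw [← h1]
        exact hS
      choose b hb hgb using fun s : S => hS' s.2
      refine hd S (fun s hs => ⟨b ⟨s, hs⟩, hgb ⟨s, hs⟩⟩) ?_
      have e : ((↑) : S → N.carrier) = toRingHom g₁ ∘ b := funext fun s => (hgb s).symm
      rw [hP, h2, e, algebraicIndependent_map_iff] at hi
      have h4 := (algebraicIndependent_map_iff (toRingHom g₁) _ b).2
        (hind.algebraicIndependent hb hi)
      rw [← e] at h4
      refine h4.of_subfield_le ?_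
      rintro _ ⟨y, rfl⟩
      exact ⟨y.1, y.2, hgE y.1 y.2⟩
    · rw [h3]
      rintro _ ⟨y, -, rfl⟩
      exact ⟨y, rfl⟩
  · rintro (i | ⟨p, hp⟩)
    · rfl
    · exact (hgE p (subset_eaClosure _ hp)).symm

end ExpFields

/-! ### Amalgamation of three fields -/

theorem RingHom.fieldRange_comp_le {K : Type u} {L : Type v} {F : Type w} [Field K] [Field L]
    [Field F] (g : L →+* F) (f : K →+* L) : (g.comp f).fieldRange ≤ g.fieldRange := by
  rintro _ ⟨a, rfl⟩
  exact ⟨f a, rfl⟩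

theorem fieldRange_comp {K : Type u} {L : Type v} {F : Type w} [Field K] [Field L]
    [Field F] (g : L →+* F) (f : K →+* L) : (g.comp f).fieldRange = f.fieldRange.map g := by
  ext x
  simp [RingHom.mem_fieldRange, Subfield.mem_map]

theorem isAlgClosed_of_mem_iff {F : Type u} [Field F] [IsAlgClosed F] {K P : Subfield F}
    (h : ∀ x, x ∈ P ↔ IsAlgebraic K x) : IsAlgClosed P := by
  have hP : P = algSubfield K F := by
    ext x
    exact h x
  subst hP
  exact isAlgClosed_of_forall_mem fun x hx => mem_algSubfield_of_isAlgebraic hx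

section Field

variable {E K₁ K₂ K₃ K₁₂ K₁₃ K₂₃ : Type u} [Field E] [Field K₁] [Field K₂] [Field K₃] [Field K₁₂]
  [Field K₁₃] [Field K₂₃] [IsAlgClosed E] [IsAlgClosed K₁] [IsAlgClosed K₂] [IsAlgClosed K₃]
  [IsAlgClosed K₁₂] [IsAlgClosed K₁₃] [IsAlgClosed K₂₃]

/-- Three free amalgams over a common algebraically closed field can be amalgamated in such a way
that the only additive relations are the obvious ones. -/
theorem exists_three_amalgam (m₁ : E →+* K₁) (m₂ : E →+* K₂) (m₃ : E →+* K₃)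
    (p₁₂ : K₁ →+* K₁₂) (q₁₂ : K₂ →+* K₁₂) (p₁₃ : K₁ →+* K₁₃) (q₁₃ : K₃ →+* K₁₃)
    (p₂₃ : K₂ →+* K₂₃) (q₂₃ : K₃ →+* K₂₃) (h₁₂ : p₁₂.comp m₁ = q₁₂.comp m₂)
    (h₁₃ : p₁₃.comp m₁ = q₁₃.comp m₃) (h₂₃ : p₂₃.comp m₂ = q₂₃.comp m₃)
    (i₁₂ : AlgDisjoint p₁₂.fieldRange q₁₂.fieldRange (p₁₂.comp m₁).fieldRange)
    (i₂₃ : AlgDisjoint p₂₃.fieldRange q₂₃.fieldRange (p₂₃.comp m₂).fieldRange)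
    (i₁₃ : AlgDisjoint q₁₃.fieldRange p₁₃.fieldRange (q₁₃.comp m₃).fieldRange) :
    ∃ (L : Type u) (_ : Field L) (_ : IsAlgClosed L) (g₁₂ : K₁₂ →+* L) (g₁₃ : K₁₃ →+* L)
      (g₂₃ : K₂₃ →+* L), (∀ x, g₁₂ (p₁₂ x) = g₁₃ (p₁₃ x)) ∧ (∀ x, g₁₂ (q₁₂ x) = g₂₃ (p₂₃ x)) ∧
      (∀ x, g₁₃ (q₁₃ x) = g₂₃ (q₂₃ x)) ∧
      (∀ x y z, g₁₂ x + g₁₃ y + g₂₃ z = 0 → ∃ r s t, x = p₁₂ r + q₁₂ s ∧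
        y = q₁₃ t + p₁₃ (-r) ∧ z = p₂₃ (-s) + q₂₃ (-t)) ∧
      AlgDisjoint (g₁₂.comp p₁₂).fieldRange g₂₃.fieldRange
        ((g₁₂.comp p₁₂).comp m₁).fieldRange := by
  -- the free amalgam of `M₁` and `M₂₃`
  obtain ⟨N₀, _, _, a₁, a, ha, hd₀⟩ := exists_free_amalgam m₁ (p₂₃.comp m₂)
  let a₂ := a.comp p₂₃
  let a₃ := a.comp q₂₃
  let C := (a.comp (p₂₃.comp m₂)).fieldRange
  have hC : IsAlgClosed C := RingHom.isAlgClosed_fieldRange _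
  have hB : IsAlgClosed a.fieldRange := RingHom.isAlgClosed_fieldRange _
  have hA₁ : IsAlgClosed a₁.fieldRange := RingHom.isAlgClosed_fieldRange _
  have hA₂ : IsAlgClosed a₂.fieldRange := RingHom.isAlgClosed_fieldRange _
  have hA₃ : IsAlgClosed a₃.fieldRange := RingHom.isAlgClosed_fieldRange _
  have hm₁ : C = (a₁.comp m₁).fieldRange := by rw [ha]
  have hm₃ : a₂.comp m₂ = a₃.comp m₃ := by
    rw [RingHom.comp_assoc, RingHom.comp_assoc, h₂₃]
  have hCA₁ : C ≤ a₁.fieldRange := hm₁ ▸ RingHom.fieldRange_comp_le _ _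
  have hCB : C ≤ a.fieldRange := RingHom.fieldRange_comp_le _ _
  have hCA₂ : C ≤ a₂.fieldRange := RingHom.fieldRange_comp_le a₂ m₂
  have hC₃ : C = (a₃.comp m₃).fieldRange := by rw [← hm₃]; rfl
  have hCA₃ : C ≤ a₃.fieldRange := hC₃ ▸ RingHom.fieldRange_comp_le _ _
  have hA₂B : a₂.fieldRange ≤ a.fieldRange := RingHom.fieldRange_comp_le _ _
  have hA₃B : a₃.fieldRange ≤ a.fieldRange := RingHom.fieldRange_comp_le _ _
  have hd₂₃ : AlgDisjoint a₂.fieldRange a₃.fieldRange C := by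
    have := (algDisjoint_map_iff a).2 i₂₃
    rwa [← fieldRange_comp, ← fieldRange_comp, ← fieldRange_comp] at this
  -- embeddings of the algebraic closures of `M₁M₂` and `M₁M₃`
  obtain ⟨P₁₂, ψ₁₂, hP₁₂, hψ₁₂, hψ₂₁⟩ := AlgDisjoint.exists_lift m₁ m₂
    a₁ a₂ ha (by rw [← hm₁]; exact hd₀.mono_right hA₂B) p₁₂ q₁₂
    (h₁₂) i₁₂
  obtain ⟨P₁₃, ψ₁₃, hP₁₃, hψ₁₃, hψ₃₁⟩ := AlgDisjoint.exists_lift m₁ m₃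
    a₁ a₃ (ha.trans hm₃) (by rw [← hm₁]; exact hd₀.mono_right hA₃B) p₁₃ q₁₃
    h₁₃ (by
      have := i₁₃.symm (by rw [← h₁₃]; exact RingHom.fieldRange_comp_le _ _)
      rwa [← h₁₃] at this)
  have hP₁₂' : IsAlgClosed P₁₂ := isAlgClosed_of_mem_iff hP₁₂
  have hP₁₃' : IsAlgClosed P₁₃ := isAlgClosed_of_mem_iff hP₁₃
  have hA₁P : a₁.fieldRange ≤ P₁₃ := by
    rintro _ ⟨x, rfl⟩
    exact (hψ₁₃ x).1
  -- A family in `K₂` independent over `C` is independent over `K₃`, and then, since `K₁` is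
  -- disjoint from `K₂₃` over `C`, over the algebraic closure of `K₁K₃`.
  have hd₂ : AlgDisjoint a₂.fieldRange P₁₃ C := by
    intro S hS hi
    refine hd₀.algebraicIndependent_of_isAlgebraic hCA₃ hA₃B (fun s => hA₂B (hS s.2))
      (hd₂₃ S hS hi) fun y hy => ?_
    rw [sup_comm]
    exact (hP₁₃ y).1 hy
  -- The algebraic closures of `K₁K₂` and `K₁K₃` meet only in `K₁`.
  have hinf : P₁₂ ⊓ P₁₃ ≤ a₁.fieldRange := fun x hx => by
    refine hd₂.mem_of_isAlgebraic hCA₂ (hCA₁.trans hA₁P) hC hP₁₃' hCA₁ hA₁P hA₁ ?_ hx.2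
    rw [sup_comm]
    exact (hP₁₂ x).1 hx.1
  -- free amalgams with `M₁₂` and with `M₁₃`
  obtain ⟨N₁, _, _, b₁₂, b, hb, hd₁₂⟩ := exists_free_amalgam ψ₁₂ P₁₂.subtype
  obtain ⟨L, _, _, c₁₃, c, hc, hd₁₃⟩ := exists_free_amalgam ψ₁₃ (b.comp P₁₃.subtype)
  have hb' : ∀ x : P₁₂, b₁₂ (ψ₁₂ x) = b x := fun x => congr($hb x)
  have hc' : ∀ x : P₁₃, c₁₃ (ψ₁₃ x) = c (b x) := fun x => congr($hc x)
  have hi₁₂ := hd₁₂.inf_le (by rw [← hb]; exact RingHom.fieldRange_comp_le _ _)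
    (RingHom.fieldRange_comp_le _ _) (RingHom.isAlgClosed_fieldRange _)
    (RingHom.isAlgClosed_fieldRange _)
  have hi₁₃ := hd₁₃.inf_le (by rw [← hc]; exact RingHom.fieldRange_comp_le _ _)
    (RingHom.fieldRange_comp_le _ _) (RingHom.isAlgClosed_fieldRange _)
    (RingHom.isAlgClosed_fieldRange _)
  let g₁₂ := c.comp b₁₂
  let g₂₃ := c.comp (b.comp a)
  have e₁ : ∀ x, g₁₂ (p₁₂ x) = c₁₃ (p₁₃ x) := fun x => by
    rw [← (hψ₁₃ x).2, hc', ← (hψ₁₂ x).2, RingHom.comp_apply, hb']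
  have e₂ : ∀ x, g₁₂ (q₁₂ x) = g₂₃ (p₂₃ x) := fun x => by
    rw [← (hψ₂₁ x).2, RingHom.comp_apply, hb']
    rfl
  have e₃ : ∀ x, c₁₃ (q₁₃ x) = g₂₃ (q₂₃ x) := fun x => by
    rw [← (hψ₃₁ x).2, hc']
    rfl
  have hdec : ∀ x y z, g₁₂ x + c₁₃ y + g₂₃ z = 0 → ∃ r s t,
      x = p₁₂ r + q₁₂ s ∧ y = q₁₃ t + p₁₃ (-r) ∧
      z = p₂₃ (-s) + q₂₃ (-t) := by
    -- Freeness of the last two amalgams pushes the relation down to `N₀`: first `y` is found in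
    -- `P₁₃`, then `x` in `P₁₂`.
    intro x y z hxyz
    have hy₁ : c₁₃ y = c (-(b₁₂ x + b (a z))) := by
      rw [map_neg, map_add]
      have h := hxyz
      simp only [g₁₂, g₂₃, RingHom.comp_apply] at h
      linear_combination h
    obtain ⟨y', hy'⟩ := hi₁₃ ⟨⟨y, rfl⟩, ⟨_, hy₁.symm⟩⟩
    have hy'' : y = ψ₁₃ y' := c₁₃.injective (by rw [hc']; exact hy'.symm)
    have hx₁ : b₁₂ x = b (-(y' + a z)) := by
      apply c.injective
      have h : c (b y') = c₁₃ y := hy'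
      rw [hy₁] at h
      have := c.injective h
      rw [map_neg, map_add]
      rw [this]
      congr 1
      ring
    obtain ⟨x', hx'⟩ := hi₁₂ ⟨⟨x, rfl⟩, ⟨_, hx₁.symm⟩⟩
    have hx'' : x = ψ₁₂ x' := b₁₂.injective (by rw [hb']; exact hx'.symm)
    have hsum : (x' : N₀) + y' = a (-z) := by
      have h : b x' = b₁₂ x := hx'
      rw [hx₁] at h
      rw [b.injective h, map_neg]
      ring
    -- The sum of `x'` in `P₁₂` and `y'` in `P₁₃` lies in `K₂₃`, so it splits as `s + t` with `s` in
    -- `K₂` and `t` in `K₃`. The discrepancy `x' - s = t - y'` lies in `P₁₂ ⊓ P₁₃`, which is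
    -- contained in `K₁`.
    obtain ⟨_, ⟨s, rfl⟩, _, ⟨t, rfl⟩, hst⟩ := hd₀.exists_add_eq hCA₁ hCB hC hB hCA₂ hA₂B hA₂ hCA₃
      hA₃B hA₃ ((hP₁₂ x').1 x'.2) ((hP₁₃ y').1 y'.2) (by rw [hsum]; exact ⟨_, rfl⟩)
    obtain ⟨r, hr⟩ : (x' : N₀) - a₂ s ∈ a₁.fieldRange := by
      refine hinf ⟨sub_mem x'.2 (hψ₂₁ s).1, ?_⟩
      have : (x' : N₀) - a₂ s = a₃ t - y' := by linear_combination hst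
      rw [this]
      exact sub_mem (hψ₃₁ t).1 y'.2
    refine ⟨r, s, t, ?_, ?_, ?_⟩
    · rw [hx'', ← (hψ₁₂ r).2, ← (hψ₂₁ s).2, ← map_add]
      congr 1
      apply Subtype.ext
      change (x' : N₀) = a₁ r + a₂ s
      rw [hr]
      ring
    · rw [hy'', ← (hψ₁₃ (-r)).2, ← (hψ₃₁ t).2, ← map_add]
      congr 1
      apply Subtype.ext
      change (y' : N₀) = a₃ t + a₁ (-r)
      rw [map_neg, hr]
      linear_combination hst
    · apply a.injective
      rw [hst] at hsum
      rw [map_add, map_neg, map_neg, map_neg, map_neg]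
      rw [map_neg] at hsum
      change a z = -a₂ s + -a₃ t
      linear_combination hsum
  have h1 := (algDisjoint_map_iff (c.comp b)).2 hd₀
  rw [← fieldRange_comp, ← fieldRange_comp, ← fieldRange_comp, ← ha] at h1
  have h2 : (c.comp b).comp a₁ = g₁₂.comp p₁₂ := RingHom.ext fun x => by
    rw [RingHom.comp_apply g₁₂, ← (hψ₁₂ x).2, RingHom.comp_apply c, hb']
    rfl
  rw [← RingHom.comp_assoc, h2] at h1
  exact ⟨L, _, inferInstance, g₁₂, c₁₃, g₂₃, e₁, e₂, e₃, hdec, h1⟩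

end Field

/-! ### 3-amalgamation of EA-fields -/

namespace ExpFields

theorem eaIndep_range_iff {M M₁ M₂ N : EAField.{u}} (f : M ⟶ N) (f₁ : M₁ ⟶ N) (f₂ : M₂ ⟶ N)
    (h₁ : (toRingHom f).fieldRange ≤ (toRingHom f₁).fieldRange)
    (h₂ : (toRingHom f).fieldRange ≤ (toRingHom f₂).fieldRange) :
    EAIndep N (Set.range f₁) (Set.range f₂) (Set.range f) ↔
      AlgDisjoint (toRingHom f₁).fieldRange (toRingHom f₂).fieldRange (toRingHom f).fieldRange := by
  rw [← eaIndep_iff_of_isEASubfield (isEASubfield_fieldRange f₁) (isEASubfield_fieldRange f₂)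
    (isEASubfield_fieldRange f) h₁ h₂]
  rfl

theorem threeAmalgamation_eaIndep : IndepRel.ThreeAmalgamation (C := EAField.{u}) EAIndep := by
  intro M M₁ M₂ M₃ M₁₂ M₁₃ M₂₃ m₁ m₂ m₃ p₁₂ q₁₂ p₁₃ q₁₃ p₂₃ q₂₃ h₁₂ h₁₃ h₂₃ i₁₂ i₂₃ i₁₃
  have j₁₂ := (eaIndep_range_iff (m₁ ≫ p₁₂) p₁₂ q₁₂ (RingHom.fieldRange_comp_le _ _)
    (by rw [h₁₂]; exact RingHom.fieldRange_comp_le _ _)).1 i₁₂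
  have j₂₃ := (eaIndep_range_iff (m₂ ≫ p₂₃) p₂₃ q₂₃ (RingHom.fieldRange_comp_le _ _)
    (by rw [h₂₃]; exact RingHom.fieldRange_comp_le _ _)).1 i₂₃
  have j₁₃ := (eaIndep_range_iff (m₃ ≫ q₁₃) q₁₃ p₁₃ (RingHom.fieldRange_comp_le _ _)
    (by rw [← h₁₃]; exact RingHom.fieldRange_comp_le _ _)).1 i₁₃
  obtain ⟨L, _, _, g₁₂, g₁₃, g₂₃, e₁, e₂, e₃, hdec, hd⟩ := exists_three_amalgam
    (toRingHom m₁) (toRingHom m₂) (toRingHom m₃) (toRingHom p₁₂) (toRingHom q₁₂) (toRingHom p₁₃)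
    (toRingHom q₁₃) (toRingHom p₂₃) (toRingHom q₂₃) (congrArg toRingHom h₁₂)
    (congrArg toRingHom h₁₃) (congrArg toRingHom h₂₃) j₁₂ j₂₃ j₁₃
  have hL : CharZero L := charZero_of_injective_ringHom g₁₂.injective
  obtain ⟨e, he₁₂, he₁₃, he₂₃⟩ := exists_exp_extension g₁₂ g₁₃ g₂₃ fun x y z hxyz => by
    obtain ⟨r, s, t, rfl, rfl, rfl⟩ := hdec x y z hxyz
    simp only [expo_add, ← toRingHom_expo, map_mul]
    rw [e₁, e₂, e₃]
    have h1 : ∀ {K K' : EAField.{u}} (f : K ⟶ K') (k : K'.carrier →+* L) (v : K.carrier),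
        k (toRingHom f (expo v)) * k (toRingHom f (expo (-v))) = 1 := fun f k v => by
      rw [← map_mul, ← map_mul, expo_mul_expo_neg, map_one, map_one]
    -- After identification in `L`, the product contains the exponentials of `r`, `s`, `t` and of
    -- their negatives once each; the three pairs cancel one after the other.
    linear_combination
      g₂₃ (toRingHom p₂₃ (expo s)) * g₂₃ (toRingHom p₂₃ (expo (-s))) *
        (g₂₃ (toRingHom q₂₃ (expo t)) * g₂₃ (toRingHom q₂₃ (expo (-t)))) * h1 p₁₃ g₁₃ r +
      g₂₃ (toRingHom p₂₃ (expo s)) * g₂₃ (toRingHom p₂₃ (expo (-s))) * h1 q₂₃ g₂₃ t +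
      h1 p₂₃ g₂₃ s
  refine ⟨EAField.ofAddHom L e, EAField.arrow g₁₂ he₁₂, EAField.arrow g₁₃ he₁₃,
    EAField.arrow g₂₃ he₂₃, arrow_ext e₁, arrow_ext e₂, arrow_ext e₃, ?_⟩
  have hle : (toRingHom (m₁ ≫ p₁₂ ≫ EAField.arrow g₁₂ he₁₂)).fieldRange ≤
      (toRingHom (EAField.arrow g₂₃ he₂₃)).fieldRange := by
    rintro _ ⟨x, rfl⟩
    refine ⟨toRingHom p₂₃ (toRingHom m₂ x), (e₂ _).symm.trans ?_⟩
    change g₁₂ (toRingHom (m₂ ≫ q₁₂) x) = g₁₂ (toRingHom (m₁ ≫ p₁₂) x)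
    rw [h₁₂]
  exact (eaIndep_range_iff (m₁ ≫ p₁₂ ≫ EAField.arrow g₁₂ he₁₂) (p₁₂ ≫ EAField.arrow g₁₂ he₁₂)
    (EAField.arrow g₂₃ he₂₃) (RingHom.fieldRange_comp_le _ _) hle).2 hd

end ExpFields

namespace ExpFields

/-! ### Cardinalities of EA-closures -/

section Card

theorem exists_subfield_mk_le {F : Type u} [ExponentialField F] (K : Subfield F) :
    ∃ K' : Subfield F, K ≤ K' ∧
      (∀ a ∈ K, expo a ∈ K') ∧ (∀ x, IsAlgebraic K x → x ∈ K') ∧ #K' ≤ max #K ℵ₀ := by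
  let R := Subfield.closure ((K : Set F) ∪ expo '' (K : Set F))
  have hR : ∀ x ∈ R, x ∈ algSubfield R F := fun x hx => isAlgebraic_algebraMap (⟨x, hx⟩ : R)
  have hK : K ≤ R := fun x hx => Subfield.subset_closure (Or.inl hx)
  refine ⟨algSubfield R F, fun x hx => hR x (hK hx),
    fun a ha => hR _ (Subfield.subset_closure (Or.inr ⟨a, ha, rfl⟩)),
    fun x hx => hx.of_subfield_le hK, (Algebraic.cardinalMk_le_max R F).trans
      (max_le ((Subfield.cardinalMk_closure_le_max _).trans
        (max_le ((mk_union_le _ _).trans ?_) (le_max_right _ _))) (le_max_right _ _))⟩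
  exact (add_le_add (le_max_left _ _) (mk_image_le.trans (le_max_left _ _))).trans
    (add_eq_self (le_max_right _ _)).le

variable {F : Type u} [ExponentialField F] [IsAlgClosed F]

/-- Adjoining exponentials and algebraic elements is iterated `ω` times. An exponential or an
algebraic equation over the union already lives at a finite stage, so it is solved at the next one.
-/
theorem exists_isEASubfield_mk_le (A : Set F) :
    ∃ S : Subfield F, IsEASubfield S ∧ A ⊆ S ∧ #S ≤ max #A ℵ₀ := by
  choose next hle hexp halg hmk using exists_subfield_mk_le (F := F)
  obtain ⟨T, hT0, hT⟩ : ∃ T : ℕ → Subfield F, T 0 = Subfield.closure A ∧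
      ∀ n, T (n + 1) = next (T n) :=
    ⟨Nat.rec (Subfield.closure A) fun _ => next, rfl, fun _ => rfl⟩
  have hmono : Monotone T := monotone_nat_of_le_succ fun n => hT n ▸ hle (T n)
  have hd : Directed (· ≤ ·) T := hmono.directed_le
  have hcard : ∀ n, #↥(T n) ≤ max #A ℵ₀ := by
    intro n
    induction n with
    | zero => exact hT0 ▸ Subfield.cardinalMk_closure_le_max A
    | succ n ih => exact hT n ▸ (hmk (T n)).trans (max_le ih (le_max_right _ _))
  refine ⟨⨆ n, T n, IsEASubfield.of_isAlgebraic (fun a ha => ?_) fun x hx => ?_,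
    Subfield.subset_closure.trans (hT0 ▸ le_iSup T 0), ?_⟩
  · obtain ⟨n, hn⟩ := (Subfield.mem_iSup_of_directed hd).1 ha
    exact le_iSup T (n + 1) (hT n ▸ hexp (T n) a hn)
  · obtain ⟨n, hn⟩ := exists_isAlgebraic_of_directed hd hx
    exact le_iSup T (n + 1) (hT n ▸ halg (T n) x hn)
  · have h : ((⨆ n, T n : Subfield F) : Set F) =
        ⋃ n : ULift.{u} ℕ, ((T n.down : Subfield F) : Set F) := by
      ext x
      simp [Subfield.mem_iSup_of_directed hd]
    change #((⨆ n, T n : Subfield F) : Set F) ≤ _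
    rw [h]
    refine (mk_iUnion_le _).trans ?_
    rw [← mul_eq_self (le_max_right #A ℵ₀)]
    exact mul_le_mul' ((mk_uLift ℕ).trans_le (by simp)) (ciSup_le' fun n => hcard n.down)

theorem mk_eaClosure_le (A : Set F) : #(eaClosure A) ≤ max #A ℵ₀ := by
  obtain ⟨S, hS, hA, h⟩ := exists_isEASubfield_mk_le A
  exact (mk_le_mk_of_subset (eaClosure_le hS hA)).trans h

theorem countable_eaClosure {A : Set F} (hA : A.Countable) :
    (eaClosure A : Set F).Countable :=
  le_aleph0_iff_set_countable.1 ((mk_eaClosure_le A).trans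
    (max_le (le_aleph0_iff_set_countable.2 hA) le_rfl))

end Card

/-! ### Club local character -/

theorem algebraicIndependent_of_forall_finite {F : Type u} [Field F] {K : Subfield F}
    {ι : Type*} {x : ι → F}
    (h : ∀ T : Set F, T.Finite → T ⊆ K → ∃ K' : Subfield F, T ⊆ K' ∧ AlgebraicIndependent K' x) :
    AlgebraicIndependent K x := by
  classical
  rw [algebraicIndependent_iff]
  intro p hp
  obtain ⟨K', hK', hi⟩ := h ((↑) '' (p.coeffs : Set K)) (p.coeffs.finite_toSet.image _)
    (by rintro _ ⟨a, -, rfl⟩; exact a.2)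
  have hr : p.map (algebraMap K F) ∈ Set.range (MvPolynomial.map (σ := ι) (algebraMap K' F)) := by
    refine MvPolynomial.mem_range_map_iff_coeffs_subset.2 fun a ha => ?_
    obtain ⟨b, hb, rfl⟩ := Finset.mem_image.1 (MvPolynomial.coeffs_map _ _ ha)
    exact ⟨⟨_, hK' ⟨b, hb, rfl⟩⟩, rfl⟩
  obtain ⟨q, hq⟩ := hr
  have hq0 : MvPolynomial.aeval x q = 0 := by
    rw [MvPolynomial.aeval_def, ← MvPolynomial.eval_map, hq, MvPolynomial.eval_map]
    exact hp
  rw [algebraicIndependent_iff.1 hi q hq0, map_zero, eq_comm] at hq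
  exact MvPolynomial.map_injective _ (algebraMap K F).injective (hq.trans (map_zero _).symm)

variable {F : Type u} [ExponentialField F] [IsAlgClosed F]

theorem exists_subset_eaClosure_of_directed {ι : Type*} [Nonempty ι] {A : ι → Set F}
    (hd : Directed (· ⊆ ·) A) {D : Set F} (hD : D.Finite) (h : D ⊆ eaClosure (⋃ i, A i)) :
    ∃ i, D ⊆ eaClosure (A i) := by
  choose i hi using fun x : D => (mem_eaClosure_iUnion hd).1 (h x.2)
  have := hD.to_subtype
  obtain ⟨j, hj⟩ := hd.finite_le i
  exact ⟨j, fun x hx => eaClosure_mono (hj ⟨x, hx⟩) (hi ⟨x, hx⟩)⟩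

/-- A dependence over `⟨B⟩^EA` has finitely many coefficients, which lie in the EA-closure of a
finite `W ⊆ B`. -/
theorem exists_finite_algebraicIndependent_eaClosure (B D : Set F) : ∃ W : Set F, W.Finite ∧
    W ⊆ B ∧ (AlgebraicIndependent (eaClosure W) ((↑) : D → F) →
      AlgebraicIndependent (eaClosure B) ((↑) : D → F)) := by
  by_contra! h
  refine (h ∅ Set.finite_empty (Set.empty_subset _)).2 ?_
  refine algebraicIndependent_of_forall_finite fun T hT hTB => ?_
  obtain ⟨W, hWB, hW, hTW⟩ := exists_finite_subset_eaClosure hT hTB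
  exact ⟨eaClosure W, hTW, (h W hW hWB).1⟩

/-- The clubset consists of all countable `Y ⊆ B` over which `A` is independent from `B`.
Unboundedness is a closing-off argument; closure under chains holds because a finite subset of `⟨A ∪
⋃ Y i⟩^EA` lies in some `⟨A ∪ Y i⟩^EA`. -/
theorem clubLocalCharacter_eaIndep :
    IndepRel.ClubLocalCharacter (C := EAField.{u}) EAIndep := by
  have hcount : ∀ {α : Type u} (Y : Set α), #Y < ℵ₁ ↔ Y.Countable := fun Y => by
    rw [← succ_aleph0, Order.lt_succ_iff, le_aleph0_iff_set_countable]
  refine ⟨ℵ₁, isRegular_aleph_one, fun M A B hA => ?_⟩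
  refine ⟨{Y | Y ⊆ B ∧ Y.Countable ∧ EAIndep M A B Y}, ⟨fun Y hY =>
    ⟨hY.1, (hcount Y).2 hY.2.1⟩, fun Z hZB hZ => ?_,
    fun ι _ _ _ Y hι hY h => ?_⟩, fun Y hY => hY.2.2⟩
  · choose W hWfin hWB hW using exists_finite_algebraicIndependent_eaClosure (F := M.carrier) B
    -- For each of the countably many finite `D` in `⟨A ∪ X⟩^EA`, a finite set is added whose
    -- EA-closure detects the dependence of `D` over `⟨B⟩^EA`.
    let next : Set M.carrier → Set M.carrier := fun X =>
      X ∪ ⋃ D ∈ {D : Set M.carrier | D.Finite ∧ D ⊆ eaClosure (A ∪ X)}, W D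
    let X : ℕ → Set M.carrier := Nat.rec Z fun _ => next
    have hX : ∀ n, X n ⊆ B ∧ (X n).Countable := by
      intro n
      induction n with
      | zero => exact ⟨hZB, (hcount Z).1 hZ⟩
      | succ n ih =>
        exact ⟨Set.union_subset ih.1 (Set.iUnion₂_subset fun D _ => hWB D),
          ih.2.union (Set.Countable.biUnion (Set.countable_ofPred_finite_subset
            (countable_eaClosure (hA.countable.union ih.2))) fun D _ => (hWfin D).countable)⟩
    have hmono : Monotone X := monotone_nat_of_le_succ fun n => Set.subset_union_left
    have hsub : (⋃ n, X n) ⊆ B := Set.iUnion_subset fun n => (hX n).1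
    refine ⟨⋃ n, X n, ⟨hsub, Set.countable_iUnion fun n => (hX n).2, ?_⟩, Set.subset_iUnion X 0⟩
    rw [eaIndep_iff, Set.union_eq_left.2 hsub]
    intro S hS hi
    refine algebraicIndependent_of_finite S fun D hDS hD => ?_
    have hDX := hDS.trans hS
    rw [Set.union_iUnion] at hDX
    obtain ⟨n, hn⟩ := exists_subset_eaClosure_of_directed
      (monotone_const.union hmono).directed_le hD hDX
    refine hW D ((hi.mono hDS).of_subfield_le (eaClosure_mono ?_))
    refine Set.Subset.trans ?_ (Set.subset_iUnion X (n + 1))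
    exact fun x hx => Or.inr (Set.mem_biUnion
      (show D ∈ {D : Set M.carrier | D.Finite ∧ D ⊆ eaClosure (A ∪ X n)} from ⟨hD, hn⟩) hx)
  · have hsub : (⋃ i, Y i) ⊆ B := Set.iUnion_subset fun i => (h i).1
    have : Countable ι := mk_le_aleph0_iff.1 (by
      rwa [← succ_aleph0, Order.lt_succ_iff] at hι)
    refine ⟨hsub, Set.countable_iUnion fun i => (h i).2.1, ?_⟩
    rw [eaIndep_iff, Set.union_eq_left.2 hsub]
    intro S hS hi
    refine algebraicIndependent_of_finite S fun D hDS hD => ?_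
    have hDX := hDS.trans hS
    rw [Set.union_iUnion] at hDX
    obtain ⟨i, hDi⟩ := exists_subset_eaClosure_of_directed
      (monotone_const.union hY).directed_le hD hDX
    have h1 := eaIndep_iff.1 (h i).2.2
    rw [Set.union_eq_left.2 (h i).1] at h1
    exact h1 D hDi ((hi.mono hDS).of_subfield_le (eaClosure_mono (Set.subset_iUnion Y i)))

end ExpFields

namespace ExpFields

/-! ### Unions of chains -/

section DirectLimit

variable {ι : Type u} [LinearOrder ι] [Nonempty ι] (G : ι → Type u) [∀ i, Field (G i)]
  (f : ∀ i j, i ≤ j → G i →+* G j) [DirectedSystem G (f · · ·)]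

/-- Inside an algebraic closure of the limit, an element algebraic over the union of the stages is
algebraic over one stage, hence lies in it. -/
theorem isAlgClosed_directLimit [∀ i, IsAlgClosed (G i)] : IsAlgClosed (DirectLimit G f) := by
  let K := AlgebraicClosure (DirectLimit G f)
  let S : ι → Subfield K := fun i =>
    ((algebraMap (DirectLimit G f) K).comp (DirectLimit.Ring.of G f i)).fieldRange
  have hS : Monotone S := by
    rintro i j h _ ⟨x, rfl⟩
    exact ⟨f i j h x, congrArg (algebraMap (DirectLimit G f) K) (DirectLimit.Ring.of_f h x)⟩
  have hr : ∀ y, algebraMap (DirectLimit G f) K y ∈ ⨆ i, S i := fun y => by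
    induction y using DirectLimit.induction with
    | _ i x => exact le_iSup S i ⟨x, rfl⟩
  refine IsAlgClosed.of_ringEquiv K _ (RingEquiv.ofBijective (algebraMap (DirectLimit G f) K)
    ⟨(algebraMap (DirectLimit G f) K).injective, fun x => ?_⟩).symm
  have hx : IsAlgebraic (⨆ i, S i : Subfield K) x :=
    (Algebra.IsAlgebraic.isAlgebraic (R := DirectLimit G f) x).ringHom_of_comp_eq
      ((algebraMap (DirectLimit G f) K).codRestrict _ hr) (RingHom.id K)
      (fun a b hab => (algebraMap (DirectLimit G f) K).injective congr(($hab).1)) rfl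
  obtain ⟨i, hi⟩ := exists_isAlgebraic_of_directed hS.directed_le hx
  obtain ⟨y, hy⟩ := Subfield.mem_of_isAlgebraic (RingHom.isAlgClosed_fieldRange _) hi
  exact ⟨_, hy⟩

/-- The lifting property for fields yields arrows out of the union; the one for additive groups
yields its exponential map. -/
theorem exists_directLimit [∀ i, IsAlgClosed (G i)] :
    ∃ (L : Type u) (_ : Field L) (_ : IsAlgClosed L) (c : ∀ i, G i →+* L),
      (∀ i j h x, c j (f i j h x) = c i x) ∧ (∀ y, ∃ i x, c i x = y) ∧
      (∀ (P : Type u) [Field P] (d : ∀ i, G i →+* P), (∀ i j h x, d j (f i j h x) = d i x) →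
        ∃ k : L →+* P, ∀ i x, k (c i x) = d i x) ∧
      ∀ (P : Type u) [AddCommGroup P] (d : ∀ i, G i →+ P), (∀ i j h x, d j (f i j h x) = d i x) →
        ∃ k : L →+ P, ∀ i x, k (c i x) = d i x := by
  refine ⟨DirectLimit G f, inferInstance, isAlgClosed_directLimit G f, DirectLimit.Ring.of G f,
    fun i j h x => DirectLimit.Ring.of_f h x, fun y => ?_, fun P _ d hd =>
    ⟨DirectLimit.Ring.lift G f P d hd, fun i x => rfl⟩, fun P _ d hd => ?_⟩
  · induction y using DirectLimit.induction with
    | _ i x => exact ⟨i, x, rfl⟩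
  · exact ⟨AddMonoidHom.mk' (DirectLimit.lift f (d · ·) fun i j h x => (hd i j h x).symm)
      (DirectLimit.lift_add (f := f) d _), fun i x => rfl⟩

end DirectLimit

theorem exists_union_of_chain (ι : Type u) [LinearOrder ι] [Nonempty ι] (D : ι ⥤ EAField.{u}) :
    ∃ (U : EAField.{u}) (c : ∀ i, D.obj i ⟶ U),
      (∀ (i j : ι) (h : i ⟶ j), D.map h ≫ c j = c i) ∧
      (⋃ i, Set.range (c i)) = Set.univ ∧
      ∀ (N : EAField.{u}) (d : ∀ i, D.obj i ⟶ N),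
        (∀ (i j : ι) (h : i ⟶ j), D.map h ≫ d j = d i) → ∃ k : U ⟶ N, ∀ i, c i ≫ k = d i := by
  have : DirectedSystem (fun i => (D.obj i).carrier)
      (fun i j h => toRingHom (D.map (homOfLE h))) :=
    ⟨fun i x => congr(toRingHom $(D.map_id i) x),
      fun _ _ _ hij hjk x => congr(toRingHom $(D.map_comp (homOfLE hij) (homOfLE hjk)) x).symm⟩
  obtain ⟨L, _, _, c, hc, hsurj, hring, hadd⟩ := exists_directLimit
    (fun i => (D.obj i).carrier) (fun i j h => toRingHom (D.map (homOfLE h)))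
  have hL : CharZero L := charZero_of_injective_ringHom (c (Classical.arbitrary ι)).injective
  obtain ⟨e, he⟩ := hadd (Additive Lˣ)
    (fun i => (MonoidHom.toAdditive (Units.map (c i : (D.obj i).carrier →* L))).comp
      (expAdd (D.obj i).carrier)) fun i j h x => by
    apply Additive.toMul.injective
    ext
    change c j (expo (toRingHom (D.map (homOfLE h)) x)) = c i (expo x)
    rw [← toRingHom_expo]
    exact hc i j h _
  have he' : ∀ i x, ((e (c i x)).toMul : L) = c i (expo x) := fun i x => by
    rw [he]
    rfl
  refine ⟨EAField.ofAddHom L e, fun i => EAField.arrow (c i) (he' i), fun i j h =>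
    arrow_ext fun x => hc i j (leOfHom h) x, Set.eq_univ_of_forall fun y => ?_, fun N d hd => ?_⟩
  · obtain ⟨i, x, hx⟩ := hsurj y
    exact Set.mem_iUnion.2 ⟨i, x, hx⟩
  · obtain ⟨k, hk⟩ := hring N.carrier (fun i => toRingHom (d i)) fun i j h x =>
      congr(toRingHom $(hd i j (homOfLE h)) x)
    refine ⟨(⟨k, fun y => ?_⟩ : ExpEmbedding (EAField.ofAddHom L e).carrier N.carrier),
      fun i => arrow_ext fun x => hk i x⟩
    obtain ⟨i, x, rfl⟩ := hsurj y
    change k ((e (c i x)).toMul : L) = expo (k (c i x))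
    rw [he', hk, hk, toRingHom_expo]

/-! ### The other axioms of an abstract elementary class -/

theorem exists_embedding {M N : EAField.{u}} (f : M ⟶ N) :
    ∃ g : M.carrier ↪[expRingLanguage] N.carrier, ∀ a, g a = f a := by
  refine ⟨⟨⟨f, (toRingHom f).injective⟩, fun {n} s x => ?_, fun r => r.elim⟩, fun _ => rfl⟩
  cases s with
  | add => exact map_add (toRingHom f) _ _
  | mul => exact map_mul (toRingHom f) _ _
  | neg => exact map_neg (toRingHom f) _
  | zero => exact map_zero (toRingHom f)
  | one => exact map_one (toRingHom f)
  | exp => exact toRingHom_expo f _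

theorem exists_arrow_of_equiv {M N : EAField.{u}} (e : M.carrier ≃[expRingLanguage] N.carrier) :
    ∃ f : M ⟶ N, ∀ a, f a = e a := by
  refine ⟨(⟨⟨⟨⟨e, ?_⟩, ?_⟩, ?_, ?_⟩, ?_⟩ : ExpEmbedding M.carrier N.carrier), fun _ => rfl⟩
  · exact e.map_fun (n := 0) ExpRingFunc.one ![]
  · exact fun a b => e.map_fun (n := 2) ExpRingFunc.mul ![a, b]
  · exact e.map_fun (n := 0) ExpRingFunc.zero ![]
  · exact fun a b => e.map_fun (n := 2) ExpRingFunc.add ![a, b]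
  · exact fun a => e.map_fun (n := 1) ExpRingFunc.exp ![a]

/-- The EA-field structure is transported along the bijection. Inverses are not in the language, so
only the operations preserved by `e` have to be compared with the given structure. -/
theorem exists_eaField_of_equiv (M : EAField.{u}) (B : Type u) [SB : expRingLanguage.Structure B]
    (e : M.carrier ≃[expRingLanguage] B) :
    ∃ N : EAField.{u}, (⟨N.carrier, inferInstance⟩ : Bundled.{u} expRingLanguage.Structure) =
      ⟨B, SB⟩ := by
  let σ := e.toEquiv.symm
  let _ : Field B := σ.field
  let r : B ≃+* M.carrier := σ.ringEquiv
  have : CharZero B := charZero_of_injective_ringHom (f := (r.symm : M.carrier →+* B)) r.symm.injective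
  have : IsAlgClosed B := IsAlgClosed.of_ringEquiv M.carrier B r.symm
  let E : B →+ Additive Bˣ :=
    ((MonoidHom.toAdditive (Units.map (r.symm : M.carrier →* B))).comp
      (expAdd M.carrier)).comp (r : B →+ M.carrier)
  refine ⟨EAField.ofAddHom B E, congrArg (fun S : expRingLanguage.Structure B =>
    (⟨B, S⟩ : Bundled.{u} expRingLanguage.Structure)) ?_⟩
  have key : ∀ {n} (s : expRingLanguage.Functions n) (x : Fin n → B),
      e (Language.Structure.funMap s fun i => σ (x i)) = Language.Structure.funMap s x := by
    intro n s x
    rw [e.map_fun]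
    exact congrArg _ (funext fun i => e.toEquiv.apply_symm_apply (x i))
  apply Language.Structure.ext
  · funext n s x
    refine Eq.trans ?_ (key s x)
    cases s <;> rfl
  · funext n r
    exact r.elim

theorem exists_comp_eq {M₁ M₂ N : EAField.{u}} (f : M₁ ⟶ N) (g : M₂ ⟶ N)
    (h : Set.range f ⊆ Set.range g) : ∃ k : M₁ ⟶ M₂, k ≫ g = f := by
  choose k hk using fun a => h ⟨a, rfl⟩
  have hk' : ∀ a, toRingHom g (k a) = toRingHom f a := hk
  have hg := (toRingHom g).injective
  refine ⟨(⟨⟨⟨⟨k, hg ?_⟩, fun a b => hg ?_⟩, hg ?_, fun a b => hg ?_⟩, fun a => hg ?_⟩ :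
    ExpEmbedding M₁.carrier M₂.carrier), arrow_ext hk'⟩
  · rw [hk', map_one, map_one]
  · rw [map_mul, hk', hk', hk', map_mul]
  · change toRingHom g (k 0) = _
    rw [hk', map_zero, map_zero]
  · change toRingHom g (k (a + b)) = toRingHom g (k a + k b)
    rw [map_add, hk', hk', hk', map_add]
  · change toRingHom g (k (expo a)) = toRingHom g (expo (k a))
    rw [toRingHom_expo, hk', hk', toRingHom_expo]

theorem isAEC_eaField : IndepRel.IsAEC expRingLanguage EAField.{u} where
  arrow_embedding := exists_embedding
  iso_arrow := exists_arrow_of_equiv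
  iso_object M B _ := fun ⟨e⟩ => exists_eaField_of_equiv M B e
  coherence := exists_comp_eq
  chains ι _ _ _ D := exists_union_of_chain ι D
  lowenheim_skolem := ⟨ℵ₀, le_rfl, fun M S =>
    ⟨(isEASubfield_eaClosure (F := M.carrier) S).toEAField, (isEASubfield_eaClosure S).incl,
      fun x hx => ⟨⟨x, subset_eaClosure S hx⟩, rfl⟩,
      (mk_eaClosure_le S).trans (max_le_iff.2 ⟨self_le_add_right _ _, self_le_add_left _ _⟩)⟩⟩

end ExpFields

/-! ### Products that are not sums -/

theorem AlgDisjoint.mul_ne_add {F : Type u} [Field F] {A B C : Subfield F}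
    (h : AlgDisjoint A B C) (hCA : C ≤ A) (hCB : C ≤ B) (hC : IsAlgClosed C) (hB : IsAlgClosed B)
    {a d x y : F} (ha : a ∈ A) (haC : a ∉ C) (hd : d ∈ B) (hdC : d ∉ C) (hx : x ∈ A)
    (hy : y ∈ B) : a * d ≠ x + y := by
  intro e
  have hdC' : ∀ α β : C, (α : F) + β * d = 0 → α = 0 ∧ β = 0 := by
    intro α β hαβ
    have hβ : β = 0 := by
      by_contra hβ
      have hβ' : (β : F) ≠ 0 := fun h => hβ (Subtype.ext h)
      refine hdC ?_
      have : d = -(α : F) / β := by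
        field_simp
        linear_combination hαβ
      rw [this]
      exact div_mem (neg_mem α.2) β.2
    subst hβ
    exact ⟨Subtype.ext (by simpa using hαβ), rfl⟩
  -- Linear disjointness is applied to `a * d - x - y = 0`. If `y = α + β * d`, the coefficient of
  -- `d` gives `a = β`, which lies in `C`; otherwise `y`, `1`, `d` are independent over `C` and the
  -- coefficient `-1` of `y` would vanish.
  by_cases hyd : ∃ α β : C, y = α + β * d
  · obtain ⟨α, β, rfl⟩ := hyd
    have hli : LinearIndependent C ![1, d] := by
      refine LinearIndependent.pair_iff.2 fun s t hst => hdC' s t ?_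
      simpa [Subfield.smul_def] using hst
    have := h.eq_zero_of_sum_mul_eq_zero hCA hCB hC hB hli
      (fun i => by fin_cases i; exacts [one_mem _, hd]) Finset.univ ![-x - α, a - β]
      (fun i => by
        fin_cases i
        exacts [sub_mem (neg_mem hx) (hCA α.2), sub_mem ha (hCA β.2)])
      (by
        simp only [Fin.sum_univ_two, Matrix.cons_val_zero, Matrix.cons_val_one]
        linear_combination e) 1 (Finset.mem_univ _)
    exact haC (sub_eq_zero.1 this ▸ β.2)
  · have hli : LinearIndependent C ![y, 1, d] := by
      refine Fintype.linearIndependent_iff.2 fun g hg => ?_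
      simp only [Fin.sum_univ_three, Subfield.smul_def, smul_eq_mul, Matrix.cons_val_zero,
        Matrix.cons_val_one, Matrix.cons_val, mul_one] at hg
      have h0 : g 0 = 0 := by
        by_contra h0
        have h0' : (g 0 : F) ≠ 0 := fun h => h0 (Subtype.ext h)
        refine hyd ⟨-g 1 / g 0, -g 2 / g 0, ?_⟩
        push_cast
        field_simp
        linear_combination hg
      have h12 := hdC' (g 1) (g 2) (by
        rw [h0] at hg
        simpa using hg)
      intro i
      fin_cases i
      exacts [h0, h12.1, h12.2]
    have := h.eq_zero_of_sum_mul_eq_zero hCA hCB hC hB hli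
      (fun i => by fin_cases i; exacts [hy, one_mem _, hd]) Finset.univ ![-1, -x, a]
      (fun i => by
        fin_cases i
        exacts [neg_mem (one_mem _), neg_mem hx, ha])
      (by
        simp only [Fin.sum_univ_three, Matrix.cons_val_zero, Matrix.cons_val_one, Matrix.cons_val]
        linear_combination e) 0 (Finset.mem_univ _)
    exact neg_ne_zero.2 one_ne_zero this

namespace ExpFields

/-! ### Failure of base monotonicity -/

theorem exists_transcendental_extension (C : EAField.{u}) :
    ∃ (A : EAField.{u}) (f : C ⟶ A) (a : A.carrier),
      AlgebraicIndependent (toRingHom f).fieldRange fun _ : Unit => a := by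
  let K := AlgebraicClosure (RatFunc C.carrier)
  let k := algebraMap C.carrier K
  let t : K := algebraMap (RatFunc C.carrier) K RatFunc.X
  have ht : AlgebraicIndependent C.carrier fun _ : Unit => t :=
    algebraicIndependent_unique_type_iff.2 ((transcendental_algebraMap_iff
      (algebraMap (RatFunc C.carrier) K).injective).2 RatFunc.transcendental_X)
  have : CharZero K := charZero_of_injective_ringHom k.injective
  obtain ⟨e, he, -⟩ := exists_exp_extension k k k fun x y z h => by
    rw [← map_add, ← map_add, map_eq_zero] at h
    rw [← map_mul, ← map_mul, ← expo_add, ← expo_add, h, expo_zero, map_one]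
  exact ⟨EAField.ofAddHom K e, EAField.arrow k he, t,
    (algebraicIndependent_fieldRange_iff k _).2 ht⟩

/-- The cyclic group generated by `c` is infinite and meets the range of `s` trivially, so the value
at `c` can be prescribed independently of those on the range. -/
theorem exists_addMonoidHom_apply_eq {L : Type u} [Field L] [IsAlgClosed L] {G : Type v}
    [AddCommGroup G] (e₀ : L →+ Additive Lˣ) (s : G →+ L) (c : L)
    (hc : ∀ (n : ℤ) g, s g = n • c → n = 0) (β : Additive Lˣ) :
    ∃ e : L →+ Additive Lˣ, (∀ g, e (s g) = e₀ (s g)) ∧ e c = β := by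
  obtain ⟨e, he⟩ := exists_addMonoidHom_extension (s.coprod (zmultiplesHom L c))
    ((e₀.comp s).coprod (zmultiplesHom (Additive Lˣ) β)) (by
      rintro ⟨g, n⟩ h
      have h' : s g + n • c = 0 := h
      have hn : n = 0 := neg_eq_zero.1 (hc (-n) g (by
        rw [neg_smul]
        exact eq_neg_of_add_eq_zero_left h'))
      subst hn
      rw [zero_smul, add_zero] at h'
      simp [h'])
  refine ⟨e, fun g => ?_, ?_⟩
  · simpa using he (g, 0)
  · simpa using he (0, 1)

/-- `A` contains `a` transcendental over `C`, and `B` contains `b` transcendental over a second copy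
`D` of `A`. In the free amalgam of `A` and `B` over `C`, the exponential is chosen so that the
product of the two copies of `a` is sent to `b`. -/
theorem exists_not_baseMonotone (C : EAField.{u}) : ∃ (F : EAField.{u}) (f : C ⟶ F)
    (A B D : Subfield F.carrier), IsEASubfield A ∧ IsEASubfield B ∧ IsEASubfield D ∧
      Set.range f ⊆ A ∧ Set.range f ⊆ D ∧ D ≤ B ∧
      EAIndep F A B (Set.range f) ∧ ¬ EAIndep F A B D := by
  obtain ⟨A, f, a, ha⟩ := exists_transcendental_extension C
  obtain ⟨B, h, b, hb⟩ := exists_transcendental_extension A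
  obtain ⟨L, _, _, g₁, g₂, hg, hd⟩ := exists_free_amalgam (toRingHom f) (toRingHom (f ≫ h))
  have : CharZero L := charZero_of_injective_ringHom g₁.injective
  have hCA : (g₂.comp (toRingHom (f ≫ h))).fieldRange ≤ g₁.fieldRange := by
    rw [← hg]
    exact RingHom.fieldRange_comp_le _ _
  have hCB : (g₂.comp (toRingHom (f ≫ h))).fieldRange ≤ g₂.fieldRange :=
    RingHom.fieldRange_comp_le _ _
  have hC := RingHom.isAlgClosed_fieldRange (g₂.comp (toRingHom (f ≫ h)))
  have hB := RingHom.isAlgClosed_fieldRange g₂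
  have haC : a ∉ (toRingHom f).fieldRange := fun hmem =>
    algebraicIndependent_unique_type_iff.1 ha
      (isAlgebraic_algebraMap (⟨a, hmem⟩ : (toRingHom f).fieldRange))
  obtain ⟨e₀, he₁, he₂⟩ := exists_exp_extension₂ f (f ≫ h) g₁ g₂ hg (hd.inf_le hCA hCB hC hB)
  have hb0 : b ≠ 0 := fun h0 => algebraicIndependent_unique_type_iff.1 hb
    (h0 ▸ isAlgebraic_zero)
  let c := g₁ a * g₂ (toRingHom h a)
  -- A nonzero integer multiple of `c` in `A + B` could be divided by that integer, making the
  -- product `c` itself a sum.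
  obtain ⟨e, he, hec⟩ := exists_addMonoidHom_apply_eq e₀
    (g₁.toAddMonoidHom.coprod g₂.toAddMonoidHom) c (by
      rintro n ⟨x, y⟩ hn
      by_contra hn0
      have hn' : (n : L) ≠ 0 := Int.cast_ne_zero.2 hn0
      have hn1 : g₁ x + g₂ y = n * c := by
        rw [← zsmul_eq_mul]
        exact hn
      refine AlgDisjoint.mul_ne_add hd hCA hCB hC hB (d := g₂ (toRingHom h a))
        (x := g₁ (x / n)) (y := g₂ (y / n)) ⟨a, rfl⟩ ?_ ⟨_, rfl⟩ ?_ ⟨_, rfl⟩ ⟨_, rfl⟩ ?_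
      · rw [← hg]
        rintro ⟨z, hz⟩
        exact haC ⟨z, g₁.injective hz⟩
      · rintro ⟨z, hz⟩
        exact haC ⟨z, (toRingHom h).injective (g₂.injective hz)⟩
      · rw [map_div₀, map_div₀, map_intCast, map_intCast, ← add_div, hn1,
          mul_div_cancel_left₀ _ hn'])
    (Additive.ofMul (Units.mk0 (g₂ b) ((map_ne_zero g₂).2 hb0)))
  have he₁' : ∀ x, ((e (g₁ x)).toMul : L) = g₁ (expo x) := fun x => by
    rw [← he₁]
    have := he (x, 0)
    simp only [AddMonoidHom.coprod_apply, map_zero, add_zero] at this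
    exact congrArg (fun z : Additive Lˣ => (z.toMul : L)) this
  have he₂' : ∀ x, ((e (g₂ x)).toMul : L) = g₂ (expo x) := fun x => by
    rw [← he₂]
    have := he (0, x)
    simp only [AddMonoidHom.coprod_apply, map_zero, zero_add] at this
    exact congrArg (fun z : Additive Lˣ => (z.toMul : L)) this
  let F := EAField.ofAddHom L e
  let G₁ : A ⟶ F := EAField.arrow g₁ he₁'
  let G₂ : B ⟶ F := EAField.arrow g₂ he₂'
  have hG : f ≫ G₁ = (f ≫ h) ≫ G₂ := arrow_ext fun x => congr($hg x)
  have hA' := isEASubfield_fieldRange G₁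
  have hB' := isEASubfield_fieldRange G₂
  have hD' := isEASubfield_fieldRange (h ≫ G₂)
  have hDB : (toRingHom (h ≫ G₂)).fieldRange ≤ (toRingHom G₂).fieldRange :=
    RingHom.fieldRange_comp_le _ _
  refine ⟨F, (f ≫ h) ≫ G₂, (toRingHom G₁).fieldRange, (toRingHom G₂).fieldRange,
    (toRingHom (h ≫ G₂)).fieldRange, hA', hB', hD', hCA, ?_, hDB, ?_, fun hind => ?_⟩
  · rintro _ ⟨x, rfl⟩
    exact ⟨toRingHom f x, rfl⟩
  · exact (eaIndep_range_iff ((f ≫ h) ≫ G₂) G₁ G₂ hCA hCB).2 hd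
  -- The image of `b` lies in `⟨A ∪ D⟩^EA` as an exponential and is transcendental over `D`, but it
  -- belongs to `B`.
  · rw [eaIndep_iff, hD'.eaClosure_eq] at hind
    have hbi : AlgebraicIndependent (toRingHom (h ≫ G₂)).fieldRange
        fun _ : Unit => toRingHom G₂ b := by
      have := (algebraicIndependent_map_iff (toRingHom G₂) _ _).2 hb
      rwa [← fieldRange_comp] at this
    have hbA : ∀ _ : Unit, toRingHom G₂ b ∈
        eaClosure (((toRingHom G₁).fieldRange : Set F.carrier) ∪ (toRingHom (h ≫ G₂)).fieldRange) :=
      fun _ => by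
      have hcl := isEASubfield_eaClosure (F := F.carrier)
        (((toRingHom G₁).fieldRange : Set F.carrier) ∪ (toRingHom (h ≫ G₂)).fieldRange)
      have hmem := hcl.expo_mem (toRingHom G₁ a * toRingHom (h ≫ G₂) a)
        (mul_mem (subset_eaClosure _ (Or.inl ⟨a, rfl⟩)) (subset_eaClosure _ (Or.inr ⟨a, rfl⟩)))
      have hexp : expo (toRingHom G₁ a * toRingHom (h ≫ G₂) a) = toRingHom G₂ b :=
        congrArg (fun z : Additive Lˣ => (z.toMul : L)) hec
      rwa [hexp] at hmem
    refine algebraicIndependent_unique_type_iff.1 (hind.algebraicIndependent hbA hbi) ?_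
    exact isAlgebraic_algebraMap (⟨toRingHom G₂ b, subset_eaClosure _ (Or.inl ⟨b, rfl⟩)⟩ :
      eaClosure (((toRingHom G₂).fieldRange : Set F.carrier) ∪ (toRingHom (h ≫ G₂)).fieldRange))

theorem nonempty_eaField : Nonempty EAField.{u} := by
  have : CharZero (ULift.{u} ℚ) :=
    charZero_of_injective_ringHom (f := ((ULift.ringEquiv (R := ℚ)).symm : ℚ →+* ULift.{u} ℚ))
      (ULift.ringEquiv (R := ℚ)).symm.injective
  have : CharZero (AlgebraicClosure (ULift.{u} ℚ)) :=
    charZero_of_injective_ringHom (algebraMap (ULift.{u} ℚ) _).injective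
  -- The zero homomorphism to the additive copy of the units is the exponential that is constantly
  -- `1`.
  exact ⟨EAField.ofAddHom (AlgebraicClosure (ULift.{u} ℚ)) 0⟩

theorem not_isSimple_eaIndep : ¬ IndepRel.IsSimple (C := EAField.{u}) EAIndep := by
  intro h
  obtain ⟨C⟩ := nonempty_eaField.{u}
  obtain ⟨F, f, A, B, D, -, -, -, -, hCD, hDB, hind, hn⟩ := exists_not_baseMonotone C
  exact hn (h.base_monotonicity F A B (Set.range f) D hind hCD hDB)

end ExpFields

theorem mainTheorem1 :
    (IndepRel.IsAEC ExpFields.expRingLanguage ExpFields.EAField.{u} ∧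
      IndepRel.HasAmalgamation ExpFields.EAField.{u}) ∧
    IndepRel.IsNSOP1Like (C := ExpFields.EAField.{u}) ExpFields.EAIndep ∧
    ¬ IndepRel.IsSimple (C := ExpFields.EAField.{u}) ExpFields.EAIndep ∧
    (∀ C : ExpFields.EAField.{u}, ∃ (F : ExpFields.EAField.{u}) (f : C ⟶ F)
      (A B D : Subfield F.carrier),
      ExpFields.IsEASubfield A ∧ ExpFields.IsEASubfield B ∧ ExpFields.IsEASubfield D ∧
      Set.range f ⊆ A ∧ Set.range f ⊆ D ∧ D ≤ B ∧
      ExpFields.EAIndep F A B (Set.range f) ∧ ¬ ExpFields.EAIndep F A B D) := by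
  exact ⟨⟨ExpFields.isAEC_eaField, ExpFields.hasAmalgamation_eaField⟩,
    ⟨ExpFields.isIndependenceRelationOn_eaIndep, ExpFields.clubLocalCharacter_eaIndep,
      ExpFields.extension_eaIndep, ExpFields.threeAmalgamation_eaIndep⟩,
    ExpFields.not_isSimple_eaIndep, ExpFields.exists_not_baseMonotone⟩
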